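/- Let $k$ be an algebraically closed field of characteristic zero and let $H$ be a Hopf algebra over $k$. Let $G(H)$ be the group of group-like elements of $H$ and let $C_0 = kG(H)$ be its span in $H$. A nonzero element $y\in H$ is called skew primitive of weight $\mu(y)=g\in G(H)$ if $\Delta(y)=y\otimes 1+g\otimes y$. For a skew primitive $y\notin C_0$ of weight $g$, a scalar $c\in k^\times$ is called a commutator of $y$ of (finite) level $n$ if $n$ is the least nonnegative integer such that $(T-c\,\mathrm{Id}_H)^n(y)\in C_0$, where $T(a)=g^{-1}ag$; if such $c$ and $n$ exist, then $c$ is unique and is denoted by $\gamma(y)$. Let $W_\times\subseteq G(H)$ be the set of weights $\mu(y)$ of all skew primitive $y\notin C_0$ that have a commutator $\gamma(y)$ of finite level which is $1$ or not a root of unity. Let $Z$ be the span of $1$ and all skew primitive elements of $H$. Let $Y_{\sqrt{\;}}$ (respectively $Y_*$) be the span of all skew primitive $y\notin C_0$ that have a commutator $\gamma(y)$ of finite level which is a root of unity different from $1$ (respectively, which is $1$ or not a root of unity). Suppose that the subgroup $\langle W_\times\rangle$ of $G(H)$ generated by $W_\times$ is abelian. Then $$\operatorname{GKdim} H\ \ge\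 \operatorname{GKdim} C_0+\dim_k Z/(C_0+Y_{\sqrt{\;}})$$ and $$\operatorname{GKdim} H\ \ge\ \operatorname{GKdim} C_0+\dim_k Y_*/(Y_*\cap C_0).$$ Here $\operatorname{GKdim} A=\sup_V\limsup_{n\to\infty}\log_n(\dim_k V^n)\in[0,\infty]$ for a nonzero algebra $A$, with $V$ ranging over the finite-dimensional subspaces of $A$ containing $1$, and infinite dimensions are read as $\infty$; no finiteness of $\operatorname{GKdim} H$ is assumed. -/

import Mathlib

open scoped TensorProduct

namespace HopfGK

/-- The Gelfand-Kirillov dimension of a `k`-algebra `A`: the supremum, over all finite dimensional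
subspaces `V` of `A` containing `1`, of `limsup_n log (dim V ^ n) / log n`. Since `1 ∈ V`, the power
`V ^ n` is the span of all products of at most `n` elements of `V`. -/
noncomputable def gkDim (k A : Type*) [Field k] [Ring A] [Algebra k A] : ENNReal :=
  ⨆ (V : Submodule k A) (_ : V.FG) (_ : (1 : A) ∈ V),
    Filter.limsup
      (fun n : ℕ => ENNReal.ofReal
        (Real.log (Module.finrank k (V ^ n : Submodule k A)) / Real.log n))
      Filter.atTop

/-- The dimension of a vector space, with all infinite cardinals identified with `∞`. -/
noncomputable def dimInf (k M : Type*) [Field k] [AddCommGroup M] [Module k M] : ENNReal :=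
  ((Cardinal.toENat (Module.rank k M) : ℕ∞) : ENNReal)

section

variable (k H : Type*) [Field k] [Ring H] [HopfAlgebra k H]

/-- `C₀ = k G(H)`: the subalgebra of `H` that is spanned by the group-like elements. -/
def groupLikeSpan : Subalgebra k H :=
  (Submodule.span k {a : H | IsGroupLikeElem k a}).toSubalgebra
    (Submodule.subset_span IsGroupLikeElem.one)
    (fun x y hx hy => by
      have h := Submodule.mul_mem_mul hx hy
      rw [Submodule.span_mul_span] at h
      refine Submodule.span_mono ?_ h
      rintro _ ⟨a, ha, b, hb, rfl⟩
      exact IsGroupLikeElem.mul ha hb)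

/-- `C₀ = k G(H)` as a subspace of `H`. -/
abbrev C₀ : Submodule k H := Subalgebra.toSubmodule (groupLikeSpan k H)

variable {k H}

/-- `y` is a `(1, g)`-primitive element, that is, a skew primitive element of weight `g`. -/
def IsSkewPrimitive (g : GroupLike k H) (y : H) : Prop :=
  y ≠ 0 ∧ Coalgebra.comul (R := k) y = y ⊗ₜ[k] (1 : H) + (g : H) ⊗ₜ[k] y

/-- The inverse conjugation `a ↦ g⁻¹ a g`, as a linear endomorphism of `H`. -/
noncomputable def invConj (g : GroupLike k H) : Module.End k H :=
  LinearMap.mulLeft k ((g⁻¹ : GroupLike k H) : H) ∘ₗ LinearMap.mulRight k (g : H)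

/-- `y ∉ C₀` is a skew primitive element of weight `g`, and the nonzero scalar `c` is a commutator
of `y` of level `n`: `n` is the least natural number with `(T - c)^n y ∈ C₀`, where `T` is the
inverse conjugation by `g`. -/
def HasCommutatorOfLevel (g : GroupLike k H) (y : H) (c : k) (n : ℕ) : Prop :=
  IsSkewPrimitive g y ∧ y ∉ C₀ k H ∧ c ≠ 0 ∧
    ((invConj g - c • (1 : Module.End k H)) ^ n) y ∈ C₀ k H ∧
    ∀ m < n, ((invConj g - c • (1 : Module.End k H)) ^ m) y ∉ C₀ k H

/-- `c` is a root of unity. -/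
def IsRootOfUnity (c : k) : Prop := ∃ n : ℕ, 0 < n ∧ c ^ n = 1

variable (k H)

/-- The set of all weights `μ(y)` of skew primitive elements `y ∉ C₀` that have a commutator (of
some finite level) which is `1` or not a root of unity. -/
def Wtimes : Set (GroupLike k H) :=
  {g | ∃ (y : H) (c : k) (n : ℕ), HasCommutatorOfLevel g y c n ∧ (c = 1 ∨ ¬ IsRootOfUnity c)}

/-- The span of `1` and all skew primitive elements. -/
def Z : Submodule k H :=
  Submodule.span k ({1} ∪ {y : H | ∃ g : GroupLike k H, IsSkewPrimitive g y})

/-- The span of all skew primitive elements with a commutator of finite level which is a root of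
unity but not `1`. -/
def Ysqrt : Submodule k H :=
  Submodule.span k {y : H | ∃ (g : GroupLike k H) (c : k) (n : ℕ),
    HasCommutatorOfLevel g y c n ∧ IsRootOfUnity c ∧ c ≠ 1}

/-- The span of all skew primitive elements with a commutator of finite level which is `1` or not a
root of unity. -/
def Ystar : Submodule k H :=
  Submodule.span k {y : H | ∃ (g : GroupLike k H) (c : k) (n : ℕ),
    HasCommutatorOfLevel g y c n ∧ (c = 1 ∨ ¬ IsRootOfUnity c)}

end

end HopfGK

namespace HopfGK

universe u v

/-! Ordered monomials in suitable skew primitive elements are linearly independent over `C₀`, as in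
a PBW basis, so each such element adds one polynomial degree of growth. For the independence, words
are filtered by weight, a letter of level `l` weighing `M + l` with `M` large. For a linear form `ψ`
that vanishes on group-likes and reads off one letter `y j`, the operator `coact ψ` acts modulo
lower weight as a twisted derivation: it sends `y j ^ s * c` to the quantum integer `1 + q + ⋯ + q ^
(s - 1)` times `y j ^ (s - 1) * (g j * c)`. If these quantum integers do not vanish, induction on
the weight gives `monomial_independent`, and counting monomials gives `gkDim_add_toENat_le`.

Conjugation by the own weight need only be scalar up to letters of smaller level. For a generalized
eigenvector with commutator `c` one has `q = c⁻¹`, and in characteristic zero the quantum integers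
are nonzero if `c` is `1` or not a root of unity. Bases of the successive level quotients then
exhaust `Ystar` modulo `C₀` (`exists_letterFamily_generic`), which gives the second inequality.

For the first inequality there are two cases. If conjugation by the own weight is locally finite
modulo `C₀` on every skew primitive element, then primary decomposition gives `Z ≤ C₀ ⊔ Ysqrt ⊔
Ystar`. Otherwise the conjugates of one element form an infinite family with `q = 0`, and the
dimension of `H` is infinite (`gkDim_eq_top_of_not_locallyFinite`). -/

lemma map_mem_of_mem_span {k V W : Type*} [Semiring k] [AddCommMonoid V] [AddCommMonoid W]
    [Module k V] [Module k W] (f : V →ₗ[k] W) {s : Set V} {S : Submodule k W}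
    (h : ∀ x ∈ s, f x ∈ S) {x : V} (hx : x ∈ Submodule.span k s) : f x ∈ S :=
  (Submodule.span_le.2 h : Submodule.span k s ≤ S.comap f) hx

/-! ### Weighted words in skew primitive letters and the coproduct -/

section Words

variable {k H : Type*} [Field k] [Ring H] [HopfAlgebra k H]

/-- The comultiplication rule of skew primitive elements of weight `g`; it also holds for `0`. -/
def SkewRel (g : GroupLike k H) (u : H) : Prop :=
  Coalgebra.comul (R := k) u = u ⊗ₜ[k] (1 : H) + (g : H) ⊗ₜ[k] u

lemma groupLike_mem_C₀ (h : GroupLike k H) : (h : H) ∈ C₀ k H :=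
  Submodule.subset_span h.2

lemma mul_mem_C₀ {a b : H} (ha : a ∈ C₀ k H) (hb : b ∈ C₀ k H) : a * b ∈ C₀ k H :=
  (groupLikeSpan k H).mul_mem ha hb

lemma C₀_induction {p : H → Prop} (h0 : p 0) (hadd : ∀ a b, p a → p b → p (a + b))
    (hsmul : ∀ (r : k) a, p a → p (r • a)) (hg : ∀ h : GroupLike k H, p h) {c : H}
    (hc : c ∈ C₀ k H) : p c := by
  have hc' : c ∈ Submodule.span k {a : H | IsGroupLikeElem k a} := hc
  induction hc' using Submodule.span_induction with
  | mem x hx => exact hg ⟨x, hx⟩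
  | zero => exact h0
  | add x y hx hy h1 h2 => exact hadd _ _ (h1 hx) (h2 hy)
  | smul r x hx h1 => exact hsmul _ _ (h1 hx)

@[simp] lemma groupLike_mul_inv (g : GroupLike k H) : (g : H) * ((g⁻¹ : GroupLike k H) : H) = 1 := by
  rw [← GroupLike.val_mul, mul_inv_cancel, GroupLike.val_one]

@[simp] lemma groupLike_inv_mul (g : GroupLike k H) : ((g⁻¹ : GroupLike k H) : H) * (g : H) = 1 := by
  rw [← GroupLike.val_mul, inv_mul_cancel, GroupLike.val_one]

/-- A linear form that vanishes on `C₀` can be replaced by one that sees the skew primitive factor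
of a product `u * h` with `h` group-like. -/
lemma exists_form_mul_groupLike (φ : H →ₗ[k] k) (hφ : ∀ c ∈ C₀ k H, φ c = 0) :
    ∃ ψ : H →ₗ[k] k, (∀ h : GroupLike k H, ψ h = 0) ∧
      ∀ (g : GroupLike k H) (u : H), SkewRel g u → ∀ h : GroupLike k H, ψ (u * h) = φ u := by
  obtain ⟨π, hπ⟩ := LinearMap.exists_extend (LinearMap.id : C₀ k H →ₗ[k] C₀ k H)
  have hπ' : ∀ h : GroupLike k H, ((π h : C₀ k H) : H) = h := fun h => by
    have := LinearMap.congr_fun hπ ⟨h, groupLike_mem_C₀ h⟩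
    exact congrArg Subtype.val this
  have hS : ∀ c ∈ C₀ k H, HopfAlgebra.antipode k c ∈ C₀ k H := fun c hc => by
    refine C₀_induction (p := fun c => HopfAlgebra.antipode k c ∈ C₀ k H) ?_ ?_ ?_ ?_ hc
    · simp
    · intro a b ha hb; rw [map_add]; exact add_mem ha hb
    · intro r a ha; rw [map_smul]; exact Submodule.smul_mem _ _ ha
    · intro h; exact groupLike_mem_C₀ h⁻¹
  set P : H →ₗ[k] H := HopfAlgebra.antipode k ∘ₗ (C₀ k H).subtype ∘ₗ π with hP
  have hPh : ∀ h : GroupLike k H, P h = ((h⁻¹ : GroupLike k H) : H) := fun h => by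
    simp [hP, hπ']
  have hPC : ∀ x, P x ∈ C₀ k H := fun x => hS _ (π x).2
  -- The form is `x ↦ φ (x₍₁₎ * P x₍₂₎)`. On `u * h` the first term of the coproduct gives `φ (u * h
  -- * h⁻¹)`, and the second gives `φ` of an element of `C₀`.
  refine ⟨φ ∘ₗ LinearMap.mul' k H ∘ₗ P.lTensor H ∘ₗ Coalgebra.comul, fun h => ?_,
    fun g u hu h => ?_⟩
  · have := h.2.comul_eq_tmul_self
    simp only [LinearMap.comp_apply, this, LinearMap.lTensor_tmul, LinearMap.mul'_apply, hPh,
      groupLike_mul_inv]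
    exact hφ _ (groupLikeSpan k H).one_mem
  · have h1 : Coalgebra.comul (R := k) (u * (h : H)) =
        (u * h) ⊗ₜ[k] (h : H) + ((g : H) * h) ⊗ₜ[k] (u * (h : H)) := by
      rw [Bialgebra.comul_mul, h.2.comul_eq_tmul_self, hu, add_mul]
      simp [Algebra.TensorProduct.tmul_mul_tmul]
    simp only [LinearMap.comp_apply, h1, map_add, LinearMap.lTensor_tmul, LinearMap.mul'_apply,
      hPh, mul_assoc, groupLike_mul_inv, mul_one]
    rw [hφ ((g : H) * (h * P (u * h))), add_zero]
    exact mul_mem_C₀ (groupLike_mem_C₀ _) (mul_mem_C₀ (groupLike_mem_C₀ _) (hPC _))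

/-- An increasing family of sets of skew primitive elements with their weights, such that each set
is stable under conjugation by the weights that occur. -/
structure IsLetterSystem (gen : ℕ → Set (GroupLike k H × H)) : Prop where
  skew : ∀ {l g u}, (g, u) ∈ gen l → SkewRel g u
  mono : Monotone gen
  conj : ∀ {l g u l' a v}, (g, u) ∈ gen l → (a, v) ∈ gen l' →
    ∃ g', (g', (a : H) * u * ((a⁻¹ : GroupLike k H) : H)) ∈ gen l

/-- Words in the letters of `gen`, with a group-like element at the end. A letter of level `l` has
weight `M + l`, and the weight of a word is at least the sum of the weights of its letters. -/
inductive IsWord (gen : ℕ → Set (GroupLike k H × H)) (M : ℕ) : ℕ → H → Prop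
  | groupLike (n : ℕ) (h : GroupLike k H) : IsWord gen M n (h : H)
  | cons {n l : ℕ} {g : GroupLike k H} {u x : H} : (g, u) ∈ gen l → IsWord gen M n x →
      IsWord gen M (M + l + n) (u * x)

/-- The span of the words of weight less than `n`. -/
def lower (gen : ℕ → Set (GroupLike k H × H)) (M n : ℕ) : Submodule k H :=
  Submodule.span k {x | ∃ e < n, IsWord gen M e x}

variable {gen : ℕ → Set (GroupLike k H × H)} {M : ℕ}

lemma IsWord.mono {n n' : ℕ} {x : H} (hx : IsWord gen M n x) (h : n ≤ n') :
    IsWord gen M n' x := by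
  induction hx generalizing n' with
  | groupLike n g => exact .groupLike _ _
  | @cons n l g u x hu hx ih =>
    obtain ⟨d, rfl⟩ := Nat.exists_eq_add_of_le h
    rw [add_assoc]
    exact .cons hu (ih (Nat.le_add_right n d))

lemma IsWord.groupLike_mul (hgen : IsLetterSystem gen) {n l : ℕ} {a : GroupLike k H} {v x : H}
    (ha : (a, v) ∈ gen l) (hx : IsWord gen M n x) : IsWord gen M n ((a : H) * x) := by
  induction hx with
  | groupLike n h =>
    rw [← GroupLike.val_mul]
    exact .groupLike _ _
  | @cons n l g u x hu hx ih =>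
    obtain ⟨g', hg'⟩ := hgen.conj hu ha
    have : (a : H) * (u * x) = (a : H) * u * ((a⁻¹ : GroupLike k H) : H) * ((a : H) * x) := by
      rw [mul_assoc _ _ ((a : H) * x), ← mul_assoc _ (a : H) x, groupLike_inv_mul, one_mul,
        mul_assoc]
    rw [this]
    exact .cons hg' ih

lemma IsWord.mul_groupLike {n : ℕ} {x : H} (hx : IsWord gen M n x) (h : GroupLike k H) :
    IsWord gen M n (x * h) := by
  induction hx with
  | groupLike n g =>
    rw [← GroupLike.val_mul]
    exact .groupLike _ _
  | cons hu hx ih =>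
    rw [mul_assoc]
    exact .cons hu ih

lemma IsWord.mem_lower {e n : ℕ} {x : H} (hx : IsWord gen M e x) (h : e < n) :
    x ∈ lower gen M n :=
  Submodule.subset_span ⟨e, h, hx⟩

lemma lower_mono {n n' : ℕ} (h : n ≤ n') : lower gen M n ≤ lower gen M n' :=
  Submodule.span_mono fun _ ⟨e, he, hx⟩ => ⟨e, he.trans_le h, hx⟩

@[simp] lemma lower_zero : lower gen M 0 = ⊥ := by
  simp [lower]

/-- To map `lower` linearly into a submodule it suffices to treat words. -/
lemma lower_map_mem {n : ℕ} (f : H →ₗ[k] H) {S : Submodule k H}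
    (h : ∀ e < n, ∀ x, IsWord gen M e x → f x ∈ S) {x : H} (hx : x ∈ lower gen M n) :
    f x ∈ S := by
  refine map_mem_of_mem_span f ?_ hx
  rintro x ⟨e, he, hx⟩
  exact h e he x hx

lemma groupLike_mul_mem_lower (hgen : IsLetterSystem gen) {n l : ℕ} {a : GroupLike k H} {v x : H}
    (ha : (a, v) ∈ gen l) (hx : x ∈ lower gen M n) : (a : H) * x ∈ lower gen M n :=
  lower_map_mem (LinearMap.mulLeft k (a : H))
    (fun _ he _ hx => (hx.groupLike_mul hgen ha).mem_lower he) hx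

lemma letter_mul_mem_lower {n l : ℕ} {a : GroupLike k H} {u x : H}
    (ha : (a, u) ∈ gen l) (hx : x ∈ lower gen M n) : u * x ∈ lower gen M (M + l + n) :=
  lower_map_mem (LinearMap.mulLeft k u)
    (fun _ he _ hx => (IsWord.cons ha hx).mem_lower (by omega)) hx

lemma mul_C₀_mem_lower {n : ℕ} {x c : H} (hx : x ∈ lower gen M n) (hc : c ∈ C₀ k H) :
    x * c ∈ lower gen M n := by
  refine C₀_induction (p := fun c => x * c ∈ lower gen M n) ?_ ?_ ?_ ?_ hc
  · simp
  · intro a b ha hb; rw [mul_add]; exact add_mem ha hb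
  · intro r a ha; rw [mul_smul_comm]; exact Submodule.smul_mem _ _ ha
  · intro h
    exact lower_map_mem (LinearMap.mulRight k (h : H))
      (fun _ he _ hx => (hx.mul_groupLike h).mem_lower he) hx

lemma C₀_le_lower {n : ℕ} (hn : 0 < n) : C₀ k H ≤ lower gen M n := fun _ hc =>
  C₀_induction (p := fun c => c ∈ lower gen M n) (zero_mem _) (fun _ _ => add_mem)
    (fun r _ => Submodule.smul_mem _ r) (fun h => (IsWord.groupLike 0 h).mem_lower hn) hc

/-- The filtration by weights is compatible with the comultiplication. -/
lemma IsWord.comul_mem (hgen : IsLetterSystem gen) {n : ℕ} {x : H} (hx : IsWord gen M n x) :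
    Coalgebra.comul (R := k) x ∈ Submodule.span k {t : H ⊗[k] H | ∃ e e' a b, e + e' = n ∧
      IsWord gen M e a ∧ IsWord gen M e' b ∧ t = a ⊗ₜ[k] b} := by
  induction hx with
  | groupLike n h =>
    rw [h.2.comul_eq_tmul_self]
    exact Submodule.subset_span ⟨n, 0, h, h, by simp, .groupLike _ _, .groupLike _ _, rfl⟩
  | @cons n l g u x hu hx ih =>
    rw [Bialgebra.comul_mul, hgen.skew hu, add_mul]
    refine add_mem ?_ ?_
    · refine map_mem_of_mem_span (LinearMap.mulLeft k _) ?_ ih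
      rintro _ ⟨e, e', a, b, he, ha, hb, rfl⟩
      exact Submodule.subset_span ⟨M + l + e, e', u * a, b, by omega, .cons hu ha, hb, by simp⟩
    · refine map_mem_of_mem_span (LinearMap.mulLeft k _) ?_ ih
      rintro _ ⟨e, e', a, b, he, ha, hb, rfl⟩
      exact Submodule.subset_span ⟨e, M + l + e', (g : H) * a, u * b, by omega,
        ha.groupLike_mul hgen hu, .cons hu hb, by simp⟩

/-- Up to terms whose left factor has a smaller weight, `Δ x` is `x ⊗ h` for a word `x` that ends
in `h`. -/
lemma IsWord.comul_sub_mem (hgen : IsLetterSystem gen) {n : ℕ} {x : H} (hx : IsWord gen M n x) :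
    ∃ h : GroupLike k H, Coalgebra.comul (R := k) x - x ⊗ₜ[k] (h : H) ∈
      Submodule.span k {t : H ⊗[k] H | ∃ e a b, e + M ≤ n ∧ IsWord gen M e a ∧
        t = a ⊗ₜ[k] b} := by
  induction hx with
  | groupLike n h =>
    refine ⟨h, ?_⟩
    rw [h.2.comul_eq_tmul_self, sub_self]
    exact zero_mem _
  | @cons n l g u x hu hx ih =>
    obtain ⟨h, ih⟩ := ih
    refine ⟨h, ?_⟩
    set R := Coalgebra.comul (R := k) x - x ⊗ₜ[k] (h : H) with hR
    have hx' : Coalgebra.comul (R := k) x = x ⊗ₜ[k] (h : H) + R := by rw [hR]; abel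
    have key : Coalgebra.comul (R := k) (u * x) - (u * x) ⊗ₜ[k] (h : H) =
        ((g : H) * x) ⊗ₜ[k] (u * (h : H)) + (u ⊗ₜ[k] (1 : H)) * R + ((g : H) ⊗ₜ[k] u) * R := by
      rw [Bialgebra.comul_mul, hgen.skew hu, hx']
      simp only [add_mul, mul_add, Algebra.TensorProduct.tmul_mul_tmul, one_mul]
      abel
    rw [key]
    refine add_mem (add_mem ?_ ?_) ?_
    · exact Submodule.subset_span ⟨n, _, _, by omega, hx.groupLike_mul hgen hu, rfl⟩
    · refine map_mem_of_mem_span (LinearMap.mulLeft k _) ?_ ih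
      rintro _ ⟨e, a, b, he, ha, rfl⟩
      exact Submodule.subset_span ⟨M + l + e, u * a, b, by omega, .cons hu ha, by simp⟩
    · refine map_mem_of_mem_span (LinearMap.mulLeft k _) ?_ ih
      rintro _ ⟨e, a, b, he, ha, rfl⟩
      exact Submodule.subset_span ⟨e, (g : H) * a, u * b, by omega,
        ha.groupLike_mul hgen hu, by simp⟩

/-- The contraction `a ⊗ b ↦ ψ b • a` of the second tensor factor. -/
noncomputable def contract (ψ : H →ₗ[k] k) : H ⊗[k] H →ₗ[k] H :=
  (TensorProduct.rid k H).toLinearMap ∘ₗ ψ.lTensor H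

@[simp] lemma contract_tmul (ψ : H →ₗ[k] k) (a b : H) :
    contract ψ (a ⊗ₜ[k] b) = ψ b • a := by
  simp [contract]

/-- The operator `x ↦ ψ x₍₂₎ • x₍₁₎`. -/
noncomputable def coact (ψ : H →ₗ[k] k) : H →ₗ[k] H := contract ψ ∘ₗ Coalgebra.comul

/-- A linear form on `H` that detects, through `φ`, the letters of level above `lev`. -/
structure IsDetector (gen : ℕ → Set (GroupLike k H × H)) (φ ψ : H →ₗ[k] k) (lev : ℕ) : Prop where
  zero : ∀ {l g u}, (g, u) ∈ gen l → l ≤ lev → φ u = 0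
  groupLike : ∀ h : GroupLike k H, ψ h = 0
  mul : ∀ {l g u}, (g, u) ∈ gen l → ∀ h : GroupLike k H, ψ (u * h) = φ u

variable {φ ψ : H →ₗ[k] k} {lev : ℕ}

/-- As `M > lev + 1`, two letters already weigh too much. What remains is a group-like element or a
single letter of level at most `lev`. -/
lemma IsDetector.word (hd : IsDetector gen φ ψ lev) (hM : lev + 1 < M) {e : ℕ} {x : H}
    (hx : IsWord gen M e x) (he : e < M + lev + 1) : ψ x = 0 := by
  cases hx with
  | groupLike n h => exact hd.groupLike h
  | @cons n l g u x hu hx =>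
    cases hx with
    | groupLike n h => rw [hd.mul hu, hd.zero hu (by omega)]
    | @cons n' l' g' u' x' hu' hx' => omega

/-- The weights of the two tensor factors of the coproduct add up to the weight of the word, and `ψ`
kills every right factor lighter than `M + lev + 1`. -/
lemma IsDetector.coact_mem (hgen : IsLetterSystem gen) (hd : IsDetector gen φ ψ lev)
    (hM : lev + 1 < M) {n : ℕ} {x : H} (hx : x ∈ lower gen M n) :
    coact ψ x ∈ lower gen M (n - (M + lev + 1)) := by
  refine lower_map_mem (coact ψ) (fun e he x hx => ?_) hx
  refine map_mem_of_mem_span (contract ψ) ?_ (hx.comul_mem hgen)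
  rintro _ ⟨e, e', a, b, rfl, ha, hb, rfl⟩
  rw [contract_tmul]
  by_cases h : e' < M + lev + 1
  · rw [hd.word hM hb h, zero_smul]
    exact zero_mem _
  · exact Submodule.smul_mem _ _ (ha.mem_lower (by omega))

lemma IsDetector.coact_letter_mul_word (hgen : IsLetterSystem gen) (hd : IsDetector gen φ ψ lev)
    {n l : ℕ} {g : GroupLike k H} {u x : H} (hM : lev + 1 < M) (hu : (g, u) ∈ gen l)
    (hx : IsWord gen M n x) :
    coact ψ (u * x) - u * coact ψ x - φ u • ((g : H) * x) ∈
      lower gen M (M + l + n - (M + lev + 1)) := by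
  obtain ⟨h, hR⟩ := hx.comul_sub_mem hgen
  set R := Coalgebra.comul (R := k) x - x ⊗ₜ[k] (h : H) with hRdef
  have hx' : Coalgebra.comul (R := k) x = x ⊗ₜ[k] (h : H) + R := by rw [hRdef]; abel
  have h1 : ∀ t : H ⊗[k] H, contract ψ ((u ⊗ₜ[k] (1 : H)) * t) = u * contract ψ t := fun t => by
    induction t with
    | zero => simp
    | tmul a b => simp
    | add a b ha hb => rw [mul_add, map_add, ha, hb, map_add, mul_add]
  have key : coact ψ (u * x) - u * coact ψ x - φ u • ((g : H) * x) =
      contract ψ (((g : H) ⊗ₜ[k] u) * R) := by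
    simp only [coact, LinearMap.comp_apply]
    rw [Bialgebra.comul_mul, hgen.skew hu, add_mul, map_add, h1, add_sub_cancel_left, hx', mul_add,
      map_add, Algebra.TensorProduct.tmul_mul_tmul, contract_tmul, hd.mul hu, add_sub_cancel_left]
  rw [key]
  refine map_mem_of_mem_span (contract ψ ∘ₗ LinearMap.mulLeft k ((g : H) ⊗ₜ[k] u)) ?_ hR
  rintro _ ⟨e, a, b, he, ha, rfl⟩
  simp only [LinearMap.comp_apply, LinearMap.mulLeft_apply, Algebra.TensorProduct.tmul_mul_tmul,
    contract_tmul]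
  -- These left factors weigh at most `n - M`, which is below the bound because `M > lev + 1`.
  exact Submodule.smul_mem _ _ ((ha.groupLike_mul hgen hu).mem_lower (by omega))

/-- The twisted Leibniz rule for `coact ψ`, up to lower terms. -/
lemma IsDetector.coact_letter_mul (hgen : IsLetterSystem gen) (hd : IsDetector gen φ ψ lev)
    {n l : ℕ} {g : GroupLike k H} {u x : H} (hM : lev + 1 < M) (hu : (g, u) ∈ gen l)
    (hx : x ∈ lower gen M (n + 1)) :
    coact ψ (u * x) - u * coact ψ x - φ u • ((g : H) * x) ∈
      lower gen M (M + l + n - (M + lev + 1)) := by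
  refine lower_map_mem (coact ψ ∘ₗ LinearMap.mulLeft k u - LinearMap.mulLeft k u ∘ₗ coact ψ -
    φ u • LinearMap.mulLeft k (g : H)) (fun e he x hx => ?_) hx
  exact lower_mono (by omega) (hd.coact_letter_mul_word hgen hM hu hx)

end Words

/-! ### Independence of ordered monomials over `C₀` -/

section Monomials

variable {k H κ : Type*} [Field k] [Ring H] [HopfAlgebra k H]

/-- Skew primitive elements `y j` of weight `g j` and level `lev j + 1` in a letter system, on which
conjugation by the own weight is multiplication by `q j` up to lower level, together with linear
forms `φ j` that show that they are linearly independent modulo lower levels. -/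
structure LetterFamily (gen : ℕ → Set (GroupLike k H × H)) (κ : Type*) where
  y : κ → H
  g : κ → GroupLike k H
  lev : κ → ℕ
  q : κ → k
  φ : κ → H →ₗ[k] k
  mem : ∀ j, (g j, y j) ∈ gen (lev j + 1)
  twist : ∀ j, ∃ g', (g', (g j : H) * y j * (((g j)⁻¹ : GroupLike k H) : H) - q j • y j) ∈
    gen (lev j)
  quantum_ne_zero : ∀ j n, 0 < n → ∑ i ∈ Finset.range n, q j ^ i ≠ 0
  φ_C₀ : ∀ j, ∀ c ∈ C₀ k H, φ j c = 0
  φ_gen : ∀ j {u}, u ∈ gen (lev j) → φ j u.2 = 0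
  φ_self : ∀ j, φ j (y j) = 1
  φ_ne : ∀ i j, i ≠ j → lev i = lev j → φ j (y i) = 0

variable {gen : ℕ → Set (GroupLike k H × H)} {M : ℕ}

/-- The monomial with exponents `d j`, in the reverse of the order of the list. -/
def monomial (y : κ → H) (d : κ → ℕ) : List κ → H
  | [] => 1
  | j :: L => monomial y d L * y j ^ d j

/-- The weight of a monomial. -/
def weight (lev : κ → ℕ) (M : ℕ) (d : κ → ℕ) : List κ → ℕ
  | [] => 0
  | j :: L => weight lev M d L + d j * (M + lev j + 1)

lemma monomial_congr (y : κ → H) {d d' : κ → ℕ} {L : List κ} (h : ∀ n ∈ L, d n = d' n) :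
    monomial y d L = monomial y d' L := by
  induction L with
  | nil => rfl
  | cons j L ih =>
    rw [monomial, monomial, ih fun n hn => h n (List.mem_cons_of_mem _ hn), h j List.mem_cons_self]

lemma weight_congr (lev : κ → ℕ) {d d' : κ → ℕ} {L : List κ} (h : ∀ n ∈ L, d n = d' n) :
    weight lev M d L = weight lev M d' L := by
  induction L with
  | nil => rfl
  | cons j L ih =>
    rw [weight, weight, ih fun n hn => h n (List.mem_cons_of_mem _ hn), h j List.mem_cons_self]

/-- Truncated subtraction is harmless here: for `n ≤ p` the hypothesis says `x = 0`, since `lower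
gen M 0 = ⊥`. -/
lemma letter_mul_mem_lower_sub {n l p : ℕ} {a : GroupLike k H} {u x : H}
    (ha : (a, u) ∈ gen l) (hx : x ∈ lower gen M (n - p)) :
    u * x ∈ lower gen M (M + l + n - p) := by
  rcases le_or_gt n p with h | h
  · rw [Nat.sub_eq_zero_of_le h, lower_zero, Submodule.mem_bot] at hx
    rw [hx, mul_zero]
    exact zero_mem _
  · exact lower_mono (by omega) (letter_mul_mem_lower ha hx)

namespace LetterFamily

variable (F : LetterFamily gen κ)

lemma pow_mul_mem_lower_sub {n p : ℕ} (j : κ) (s : ℕ) {x : H} (hx : x ∈ lower gen M (n - p)) :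
    F.y j ^ s * x ∈ lower gen M (s * (M + F.lev j + 1) + n - p) := by
  induction s with
  | zero => simpa using hx
  | succ s ih =>
    rw [pow_succ', mul_assoc]
    exact lower_mono (by rw [add_mul]; omega) (letter_mul_mem_lower_sub (F.mem j) ih)

lemma pow_mul_mem_lower {n : ℕ} (j : κ) (s : ℕ) {x : H} (hx : x ∈ lower gen M n) :
    F.y j ^ s * x ∈ lower gen M (s * (M + F.lev j + 1) + n) :=
  F.pow_mul_mem_lower_sub (p := 0) j s hx

lemma monomial_mul_mem_lower_sub {n p : ℕ} (d : κ → ℕ) (L : List κ) {x : H}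
    (hx : x ∈ lower gen M (n - p)) :
    monomial F.y d L * x ∈ lower gen M (weight F.lev M d L + n - p) := by
  induction L generalizing x n with
  | nil => simpa [monomial, weight] using hx
  | cons j L ih =>
    rw [monomial, weight, mul_assoc]
    exact lower_mono (by omega) (ih (F.pow_mul_mem_lower_sub j (d j) hx))

lemma monomial_mul_C₀_mem_lower (d : κ → ℕ) (L : List κ) {c : H} (hc : c ∈ C₀ k H) :
    monomial F.y d L * c ∈ lower gen M (weight F.lev M d L + 1) :=
  F.monomial_mul_mem_lower_sub (n := 1) (p := 0) d L (C₀_le_lower one_pos hc)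

lemma exists_detector (hgen : IsLetterSystem gen) (j : κ) :
    ∃ ψ : H →ₗ[k] k, IsDetector gen (F.φ j) ψ (F.lev j) := by
  obtain ⟨ψ, h1, h2⟩ := exists_form_mul_groupLike (F.φ j) (F.φ_C₀ j)
  exact ⟨ψ, fun hu hl => F.φ_gen j (hgen.mono hl hu), h1, fun hu h => h2 _ _ (hgen.skew hu) h⟩

variable {ψ : H →ₗ[k] k} {j : κ}

/-- Each passage of `g j` across `y j` costs a factor `q j` and an error letter of level one less,
hence a loss of one unit of weight. -/
lemma weight_mul_pow (hgen : IsLetterSystem gen) (s : ℕ) {c : H} (hc : c ∈ C₀ k H) :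
    (F.g j : H) * (F.y j ^ s * c) - F.q j ^ s • (F.y j ^ s * ((F.g j : H) * c)) ∈
      lower gen M (s * (M + F.lev j + 1)) := by
  induction s with
  | zero => simp
  | succ s ih =>
    obtain ⟨g', hv⟩ := F.twist j
    set v := (F.g j : H) * F.y j * (((F.g j)⁻¹ : GroupLike k H) : H) - F.q j • F.y j with hvdef
    have h1 : (F.g j : H) * F.y j = F.q j • (F.y j * F.g j) + v * F.g j := by
      rw [hvdef, sub_mul, mul_assoc _ _ (F.g j : H), groupLike_inv_mul, mul_one, smul_mul_assoc]
      abel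
    set z := F.y j ^ s * c with hz
    have hz' : (F.g j : H) * z ∈ lower gen M (s * (M + F.lev j + 1) + 1) :=
      groupLike_mul_mem_lower hgen (F.mem j) (F.pow_mul_mem_lower j s (C₀_le_lower one_pos hc))
    have h2 : (F.g j : H) * (F.y j ^ (s + 1) * c) -
        F.q j ^ (s + 1) • (F.y j ^ (s + 1) * ((F.g j : H) * c)) =
        F.q j • (F.y j * ((F.g j : H) * z - F.q j ^ s • (F.y j ^ s * ((F.g j : H) * c)))) +
          v * ((F.g j : H) * z) := by
      have h3 : (F.g j : H) * (F.y j ^ (s + 1) * c) = (F.g j : H) * F.y j * z := by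
        rw [hz, pow_succ']; simp only [mul_assoc]
      rw [h3, h1, mul_sub, smul_sub, mul_smul_comm, smul_smul, pow_succ' (F.q j),
        pow_succ' (F.y j), add_mul]
      simp only [mul_assoc, smul_mul_assoc]
      abel
    rw [h2]
    refine add_mem (Submodule.smul_mem _ _ ?_) ?_
    · exact lower_mono (by rw [add_mul]; omega) (letter_mul_mem_lower (F.mem j) ih)
    · exact lower_mono (by rw [add_mul]; omega) (letter_mul_mem_lower hv hz')

lemma coact_C₀ (hd : IsDetector gen (F.φ j) ψ (F.lev j)) {c : H} (hc : c ∈ C₀ k H) :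
    coact ψ c = 0 := by
  refine C₀_induction (p := fun c => coact ψ c = 0) (map_zero _) ?_ ?_ ?_ hc
  · intro a b ha hb; rw [map_add, ha, hb, add_zero]
  · intro r a ha; rw [map_smul, ha, smul_zero]
  · intro h
    simp [coact, h.2.comul_eq_tmul_self, hd.groupLike]

/-- The twisted Leibniz rule, with `g j` moved past `y j ^ s`, becomes the recursion that adds `q ^
s` to the quantum integer. For `s = 0` the sum is empty, so the truncated exponent `s - 1` does not
matter. -/
lemma coact_pow_mul (hgen : IsLetterSystem gen) (hd : IsDetector gen (F.φ j) ψ (F.lev j))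
    (hM : F.lev j + 1 < M) (s : ℕ) {c : H} (hc : c ∈ C₀ k H) :
    coact ψ (F.y j ^ s * c) -
        (∑ i ∈ Finset.range s, F.q j ^ i) • (F.y j ^ (s - 1) * ((F.g j : H) * c)) ∈
      lower gen M (s * (M + F.lev j + 1) - (M + F.lev j + 1)) := by
  induction s with
  | zero => simp [F.coact_C₀ hd hc]
  | succ s ih =>
    have h1 := hd.coact_letter_mul hgen hM (F.mem j)
      (F.pow_mul_mem_lower j s (C₀_le_lower (M := M) (gen := gen) one_pos hc))
    have h2 := F.weight_mul_pow (M := M) (j := j) hgen s hc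
    have h3 := letter_mul_mem_lower_sub (F.mem j) ih
    rw [F.φ_self, one_smul, ← mul_assoc (F.y j), ← pow_succ'] at h1
    have h4 : F.y j * ((∑ i ∈ Finset.range s, F.q j ^ i) •
        (F.y j ^ (s - 1) * ((F.g j : H) * c))) =
        (∑ i ∈ Finset.range s, F.q j ^ i) • (F.y j ^ s * ((F.g j : H) * c)) := by
      rcases s with _ | s
      · simp
      · rw [mul_smul_comm, ← mul_assoc (F.y j), ← pow_succ']; rfl
    rw [mul_sub, h4] at h3
    have e : (s + 1) * (M + F.lev j + 1) - (M + F.lev j + 1) = s * (M + F.lev j + 1) := by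
      rw [add_mul]; omega
    rw [Nat.add_sub_cancel, e]
    have e1 : M + (F.lev j + 1) + s * (M + F.lev j + 1) - (M + F.lev j + 1) =
      s * (M + F.lev j + 1) := by omega
    rw [e1] at h1 h3
    have := add_mem (add_mem h1 h2) h3
    convert this using 1
    rw [Finset.sum_range_succ, add_smul]
    abel

/-- The extra Leibniz term is `φ j (y i) • (g i * x)`. Its coefficient vanishes if `lev i ≤ lev j`;
if `lev i` is larger, the lost letter `y i` outweighs the permitted drop. Hence no commutation
relation between different letters is needed. -/
lemma coact_letter_mul_of_ne (hgen : IsLetterSystem gen)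
    (hd : IsDetector gen (F.φ j) ψ (F.lev j)) (hM : F.lev j + 1 < M) {i : κ} (hij : i ≠ j) {n : ℕ}
    {x : H} (hx : x ∈ lower gen M (n + 1)) :
    coact ψ (F.y i * x) - F.y i * coact ψ x ∈
      lower gen M (M + F.lev i + 1 + n - (M + F.lev j + 1)) := by
  have h1 := hd.coact_letter_mul hgen hM (F.mem i) hx
  have h2 : F.φ j (F.y i) • ((F.g i : H) * x) ∈
      lower gen M (M + F.lev i + 1 + n - (M + F.lev j + 1)) := by
    rcases lt_trichotomy (F.lev i) (F.lev j) with h | h | h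
    · rw [hd.zero (F.mem i) h, zero_smul]; exact zero_mem _
    · rw [F.φ_ne i j hij h, zero_smul]; exact zero_mem _
    · exact Submodule.smul_mem _ _
        (lower_mono (by omega) (groupLike_mul_mem_lower hgen (F.mem i) hx))
  simpa [add_assoc] using add_mem h1 h2

lemma coact_pow_mul_of_ne (hgen : IsLetterSystem gen)
    (hd : IsDetector gen (F.φ j) ψ (F.lev j)) (hM : F.lev j + 1 < M) {i : κ} (hij : i ≠ j) {n : ℕ}
    {x : H} (hx : x ∈ lower gen M (n + 1)) (s : ℕ) :
    coact ψ (F.y i ^ s * x) - F.y i ^ s * coact ψ x ∈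
      lower gen M (s * (M + F.lev i + 1) + n - (M + F.lev j + 1)) := by
  induction s with
  | zero => simp
  | succ s ih =>
    have h0 : F.y i ^ s * x ∈ lower gen M (s * (M + F.lev i + 1) + n + 1) := by
      rw [add_assoc]
      exact F.pow_mul_mem_lower i s hx
    have h1 := F.coact_letter_mul_of_ne hgen hd hM hij h0
    have h2 := letter_mul_mem_lower_sub (F.mem i) ih
    rw [mul_sub] at h2
    have := add_mem (lower_mono (n' := (s + 1) * (M + F.lev i + 1) + n - (M + F.lev j + 1))
      (by rw [add_mul]; omega) h1) (lower_mono (by rw [add_mul]; omega) h2)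
    convert this using 1
    rw [pow_succ']
    simp only [mul_assoc]
    abel

lemma coact_monomial_mul (hgen : IsLetterSystem gen)
    (hd : IsDetector gen (F.φ j) ψ (F.lev j)) (hM : F.lev j + 1 < M) {L : List κ} (hj : j ∉ L)
    (d : κ → ℕ) {n : ℕ} {x : H} (hx : x ∈ lower gen M (n + 1)) :
    coact ψ (monomial F.y d L * x) - monomial F.y d L * coact ψ x ∈
      lower gen M (weight F.lev M d L + n - (M + F.lev j + 1)) := by
  induction L generalizing x n with
  | nil => simp [monomial]
  | cons i L ih =>
    rw [List.mem_cons, not_or] at hj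
    have h1 := F.coact_pow_mul_of_ne hgen hd hM (Ne.symm hj.1) hx (d i)
    have h0 : F.y i ^ d i * x ∈ lower gen M (d i * (M + F.lev i + 1) + n + 1) := by
      rw [add_assoc]
      exact F.pow_mul_mem_lower i (d i) hx
    have h2 := ih hj.2 h0
    have h3 := F.monomial_mul_mem_lower_sub d L h1
    have := add_mem h2 h3
    rw [weight, add_assoc]
    convert this using 1
    rw [monomial, mul_sub]
    simp only [mul_assoc]
    abel

/-- The head of the list is the rightmost power, so the operator passes the other letters with lower
errors and then acts on `y j ^ d j * c`. -/
lemma coact_monomial (hgen : IsLetterSystem gen)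
    (hd : IsDetector gen (F.φ j) ψ (F.lev j)) (hM : F.lev j + 1 < M) {L : List κ} (hj : j ∉ L)
    (d : κ → ℕ) {c : H} (hc : c ∈ C₀ k H) :
    coact ψ (monomial F.y d (j :: L) * c) - (∑ i ∈ Finset.range (d j), F.q j ^ i) •
        (monomial F.y d L * (F.y j ^ (d j - 1) * ((F.g j : H) * c))) ∈
      lower gen M (weight F.lev M d (j :: L) - (M + F.lev j + 1)) := by
  have h1 := F.coact_monomial_mul hgen hd hM hj d
    (F.pow_mul_mem_lower j (d j) (C₀_le_lower (M := M) (gen := gen) one_pos hc))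
  have h2 := F.monomial_mul_mem_lower_sub d L (F.coact_pow_mul hgen hd hM (d j) hc)
  have := add_mem h1 h2
  rw [weight]
  convert this using 1
  rw [mul_sub, mul_smul_comm, monomial, mul_assoc]
  abel

/-- Ordered monomials of the same weight are right linearly independent over `C₀` modulo words of
lower weight. -/
theorem monomial_independent_mod_lower {ι : Type*} (hgen : IsLetterSystem gen) (γ : ℕ) :
    ∀ (L : List κ), L.Nodup → (∀ j ∈ L, F.lev j + 1 < M) →
    ∀ (S : Finset ι) (d : ι → κ → ℕ) (c : ι → H), (∀ i ∈ S, c i ∈ C₀ k H) →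
      (∀ i ∈ S, weight F.lev M (d i) L = γ) →
      (∀ i ∈ S, ∀ i' ∈ S, (∀ n ∈ L, d i n = d i' n) → i = i') →
      ∑ i ∈ S, monomial F.y (d i) L * c i ∈ lower gen M γ → ∀ i ∈ S, c i = 0 := by
  classical
  induction γ using Nat.strong_induction_on with
  | _ γ ihγ =>
  intro L
  induction L with
  | nil =>
    intro _ _ S d c hc hw hinj hsum i hi
    have hS : S = {i} := by
      ext i'
      rw [Finset.mem_singleton]
      exact ⟨fun h => hinj i' h i hi (by simp), fun h => h ▸ hi⟩
    have h0 : γ = 0 := (hw i hi).symm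
    simpa [hS, h0, monomial] using hsum
  | cons j L ihL =>
    intro hnd hlev S d c hc hw hinj hsum
    obtain ⟨hjL, hnd'⟩ := List.nodup_cons.1 hnd
    have hM := hlev j List.mem_cons_self
    set p := M + F.lev j + 1 with hp
    have hpos : ∀ i ∈ S, 0 < d i j → c i = 0 := by
      intro i₀ hi₀ hd₀
      obtain ⟨ψ, hψ⟩ := F.exists_detector hgen j
      -- A positive exponent makes `γ - p` a genuine descent, so the outer induction applies after
      -- `coact ψ`.
      have hγ : p ≤ γ := by
        rw [← hw i₀ hi₀, weight]
        exact (Nat.le_mul_of_pos_left p hd₀).trans (Nat.le_add_left _ _)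
      have h1 := hψ.coact_mem hgen hM hsum
      rw [map_sum] at h1
      have h2 : ∑ i ∈ S, (coact ψ (monomial F.y (d i) (j :: L) * c i) -
          (∑ t ∈ Finset.range (d i j), F.q j ^ t) •
            (monomial F.y (d i) L * (F.y j ^ (d i j - 1) * ((F.g j : H) * c i)))) ∈
          lower gen M (γ - p) :=
        sum_mem fun i hi => by
          have := F.coact_monomial hgen hψ hM hjL (d i) (hc i hi)
          rwa [hw i hi] at this
      rw [Finset.sum_sub_distrib] at h2
      have h3 := sub_mem h1 h2
      rw [sub_sub_cancel, ← Finset.sum_filter_add_sum_filter_not S (fun i => 0 < d i j)] at h3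
      -- Terms without `y j` disappear: their quantum integer is an empty sum.
      rw [Finset.sum_eq_zero (s := S.filter fun i => ¬ 0 < d i j), add_zero] at h3
      swap
      · intro i hi
        have : d i j = 0 := by simpa using (Finset.mem_filter.1 hi).2
        simp [this]
      have key := ihγ (γ - p) (by omega) (j :: L) hnd hlev (S.filter fun i => 0 < d i j)
        (fun i => Function.update (d i) j (d i j - 1))
        (fun i => (∑ t ∈ Finset.range (d i j), F.q j ^ t) • ((F.g j : H) * c i)) ?_ ?_ ?_ ?_ i₀
        (Finset.mem_filter.2 ⟨hi₀, hd₀⟩)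
      -- The new coefficient is a nonzero quantum integer times `g j * c i₀`, and both factors in
      -- front of `c i₀` can be cancelled.
      · have h4 := (smul_eq_zero.1 key).resolve_left (F.quantum_ne_zero j _ hd₀)
        have h5 := congrArg ((((F.g j)⁻¹ : GroupLike k H) : H) * ·) h4
        simpa only [← mul_assoc, groupLike_inv_mul, one_mul, mul_zero] using h5
      · intro i hi
        exact Submodule.smul_mem _ _
          (mul_mem_C₀ (groupLike_mem_C₀ _) (hc i (Finset.mem_filter.1 hi).1))
      · intro i hi
        obtain ⟨hi, hdi⟩ := Finset.mem_filter.1 hi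
        have h4 := hw i hi
        rw [weight] at h4
        rw [weight, weight_congr F.lev (d' := d i) fun n hn =>
          Function.update_of_ne (fun h => hjL (by rwa [h] at hn)) _ _, Function.update_self]
        obtain ⟨m, hm⟩ := Nat.exists_eq_add_of_lt hdi
        rw [hm] at h4 ⊢
        simp only [zero_add, Nat.add_sub_cancel, add_mul, one_mul] at h4 ⊢
        omega
      · intro i hi i' hi' h
        obtain ⟨hi, hdi⟩ := Finset.mem_filter.1 hi
        obtain ⟨hi', hdi'⟩ := Finset.mem_filter.1 hi'
        refine hinj i hi i' hi' fun n hn => ?_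
        have h4 := h n hn
        by_cases hnj : n = j
        · subst hnj
          simp only [Function.update_self] at h4
          omega
        · simpa only [Function.update_of_ne hnj] using h4
      · convert h3 using 2 with i hi
        rw [monomial, monomial_congr F.y (d' := d i) fun n hn =>
          Function.update_of_ne (fun h => hjL (by rwa [h] at hn)) _ _, Function.update_self]
        simp only [mul_smul_comm, mul_assoc]
    -- Only terms free of `y j` can still be nonzero, so `j` is dropped from the list at the same
    -- weight `γ`.
    have hzero := ihL hnd' (fun j hj => hlev j (List.mem_cons_of_mem _ hj))
      (S.filter fun i => d i j = 0) d c (fun i hi => hc i (Finset.mem_filter.1 hi).1) ?_ ?_ ?_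
    · intro i hi
      rcases Nat.eq_zero_or_pos (d i j) with h | h
      · exact hzero i (Finset.mem_filter.2 ⟨hi, h⟩)
      · exact hpos i hi h
    · intro i hi
      obtain ⟨hi, hdi⟩ := Finset.mem_filter.1 hi
      rw [← hw i hi, weight, hdi, zero_mul, add_zero]
    · intro i hi i' hi' h
      obtain ⟨hi, hdi⟩ := Finset.mem_filter.1 hi
      obtain ⟨hi', hdi'⟩ := Finset.mem_filter.1 hi'
      refine hinj i hi i' hi' fun n hn => ?_
      rcases List.mem_cons.1 hn with rfl | hn
      · rw [hdi, hdi']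
      · exact h n hn
    · convert hsum using 1
      rw [Finset.sum_filter]
      refine Finset.sum_congr rfl fun i hi => ?_
      split_ifs with h
      · rw [monomial, h, pow_zero, mul_one]
      · rw [hpos i hi (Nat.pos_of_ne_zero h), mul_zero]

/-- Ordered monomials are right linearly independent over `C₀`. -/
theorem monomial_independent {ι : Type*} (hgen : IsLetterSystem gen) {L : List κ} (hL : L.Nodup)
    (S : Finset ι) (d : ι → κ → ℕ) (c : ι → H) (hc : ∀ i ∈ S, c i ∈ C₀ k H)
    (hinj : ∀ i ∈ S, ∀ i' ∈ S, (∀ n ∈ L, d i n = d i' n) → i = i')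
    (hsum : ∑ i ∈ S, monomial F.y (d i) L * c i = 0) : ∀ i ∈ S, c i = 0 := by
  classical
  by_contra! hne
  obtain ⟨M, hM⟩ : ∃ M, ∀ j ∈ L, F.lev j + 1 < M := by
    refine ⟨(L.map F.lev).sum + 2, fun j hj => ?_⟩
    have := List.le_sum_of_mem (List.mem_map_of_mem (f := F.lev) hj)
    omega
  set T := S.filter fun i => c i ≠ 0 with hT
  have hTne : T.Nonempty := hne.imp fun i hi => Finset.mem_filter.2 hi
  -- Among the nonzero terms those of maximal weight are isolated; all others lie in `lower gen M
  -- γ`.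
  obtain ⟨i₀, hi₀, hmax⟩ := T.exists_max_image (fun i => weight F.lev M (d i) L) hTne
  set γ := weight F.lev M (d i₀) L with hγ
  have hsumT : ∑ i ∈ T, monomial F.y (d i) L * c i = 0 := by
    rw [← hsum, hT, Finset.sum_filter]
    refine Finset.sum_congr rfl fun i _ => ?_
    split_ifs with h
    · rfl
    · rw [not_not.1 h, mul_zero]
  have hTS : ∀ i ∈ T, i ∈ S := fun i hi => (Finset.mem_filter.1 hi).1
  refine (Finset.mem_filter.1 hi₀).2 (F.monomial_independent_mod_lower hgen γ L hL hM
    (T.filter fun i => weight F.lev M (d i) L = γ) d c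
    (fun i hi => hc i (hTS i (Finset.mem_filter.1 hi).1)) (fun i hi => (Finset.mem_filter.1 hi).2)
    (fun i hi i' hi' => hinj i (hTS i (Finset.mem_filter.1 hi).1) i'
      (hTS i' (Finset.mem_filter.1 hi').1)) ?_ i₀ (Finset.mem_filter.2 ⟨hi₀, rfl⟩))
  rw [← Finset.sum_filter_add_sum_filter_not T (fun i => weight F.lev M (d i) L = γ)] at hsumT
  rw [eq_neg_of_add_eq_zero_left hsumT]
  refine neg_mem (sum_mem fun i hi => ?_)
  obtain ⟨hi, hne⟩ := Finset.mem_filter.1 hi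
  exact lower_mono (lt_of_le_of_ne (hmax i hi) hne)
    (F.monomial_mul_C₀_mem_lower (d i) L (hc i (hTS i hi)))

end LetterFamily

end Monomials

/-! ### Comparison of growth exponents -/

section Growth

open Filter Topology

lemma tendsto_log_div_log_mul {K : ℕ} (hK : 0 < K) :
    Tendsto (fun N : ℕ => ENNReal.ofReal (Real.log N / Real.log ((K * N : ℕ) : ℝ))) atTop
      (𝓝 1) := by
  have h1 : Tendsto (fun N : ℕ => Real.log ((K * N : ℕ) : ℝ)) atTop atTop :=
    Real.tendsto_log_atTop.comp (tendsto_natCast_atTop_atTop.comp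
      (tendsto_id.const_mul_atTop' hK))
  have h2 : Tendsto (fun N : ℕ => 1 - Real.log K / Real.log ((K * N : ℕ) : ℝ)) atTop (𝓝 (1 - 0)) :=
    tendsto_const_nhds.sub (h1.const_div_atTop _)
  rw [sub_zero] at h2
  have h3 := ENNReal.tendsto_ofReal h2
  rw [ENNReal.ofReal_one] at h3
  refine h3.congr' ?_
  filter_upwards [h1.eventually_gt_atTop 0, eventually_gt_atTop 0] with N hN hN0
  congr 1
  rw [eq_div_iff hN.ne', sub_mul, div_mul_cancel₀ _ hN.ne']
  push_cast
  rw [Real.log_mul (by positivity) (by positivity)]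
  ring

/-- If `b (K * N)` is at least `N ^ w * a N`, then the growth exponent of `b` exceeds that of `a`
by at least `w`. -/
lemma limsup_log_add_le (a b : ℕ → ℕ) (w K : ℕ) (hK : 0 < K) (ha : ∀ N, 0 < a N)
    (hab : ∀ N, N ^ w * a N ≤ b (K * N)) :
    limsup (fun n : ℕ => ENNReal.ofReal (Real.log (a n) / Real.log n)) atTop + w ≤
      limsup (fun n : ℕ => ENNReal.ofReal (Real.log (b n) / Real.log n)) atTop := by
  set u : ℕ → ENNReal := fun n => ENNReal.ofReal (Real.log (a n) / Real.log n) with hu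
  set v : ℕ → ENNReal := fun n => ENNReal.ofReal (Real.log (b n) / Real.log n) with hv
  -- The factor `r` corrects `log N` to `log (K * N)` and tends to `1`; the indices `K * N` form a
  -- subsequence for `b`.
  set r : ℕ → ENNReal := fun N => ENNReal.ofReal (Real.log N / Real.log ((K * N : ℕ) : ℝ)) with hr
  have hr1 : liminf r atTop = 1 := (tendsto_log_div_log_mul hK).liminf_eq
  have h1 : limsup u atTop + w = limsup (fun n => u n + w) atTop :=
    (limsup_add_const atTop u (w : ENNReal) (by isBoundedDefault) (by isBoundedDefault)).symm
  have h2 : limsup (fun n => u n + w) atTop ≤ limsup ((fun n => u n + w) * r) atTop := by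
    have := ENNReal.le_limsup_mul (f := atTop) (u := fun n => u n + w) (v := r)
    rwa [hr1, mul_one] at this
  have hK' : Tendsto (fun N => K * N) atTop atTop := tendsto_id.const_mul_atTop' hK
  have h3 : limsup ((fun n => u n + w) * r) atTop ≤ limsup (fun N => v (K * N)) atTop := by
    refine limsup_le_limsup ?_
    filter_upwards [eventually_ge_atTop 2] with N hN
    have hN1 : (1 : ℝ) < N := by exact_mod_cast hN
    have hKN : (1 : ℝ) < ((K * N : ℕ) : ℝ) := by
      exact_mod_cast lt_of_lt_of_le hN (Nat.le_mul_of_pos_left N hK)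
    have hlN := Real.log_pos hN1
    have hlKN := Real.log_pos hKN
    have ha0 : (0 : ℝ) < a N := by exact_mod_cast ha N
    have hla : 0 ≤ Real.log (a N) := Real.log_nonneg (by exact_mod_cast ha N)
    have e : ((fun n => u n + w) * r) N = ENNReal.ofReal
        ((Real.log (a N) / Real.log N + w) * (Real.log N / Real.log ((K * N : ℕ) : ℝ))) := by
      rw [ENNReal.ofReal_mul (by positivity), ENNReal.ofReal_add (by positivity) (by positivity),
        ENNReal.ofReal_natCast]
      rfl
    rw [e]
    refine ENNReal.ofReal_le_ofReal ?_
    rw [← mul_div_assoc]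
    refine div_le_div_of_nonneg_right ?_ hlKN.le
    rw [add_mul, div_mul_cancel₀ _ hlN.ne', ← Real.log_pow, ← Real.log_mul ha0.ne' (by positivity)]
    refine Real.log_le_log (by positivity) ?_
    rw [mul_comm]
    exact_mod_cast hab N
  have h4 : limsup (fun N => v (K * N)) atTop ≤ limsup v atTop := by
    have := limsup_le_limsup_of_le (u := v) hK'
    exact this
  rw [h1]
  exact (h2.trans h3).trans h4

end Growth

/-! ### From independent monomials to the Gelfand-Kirillov dimension -/

section GKDim

variable {k H κ : Type*} [Field k] [Ring H] [HopfAlgebra k H]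
  {gen : ℕ → Set (GroupLike k H × H)}

lemma pow_le_pow_of_one_mem {A : Type*} [Ring A] [Algebra k A] {W : Submodule k A}
    (hW : (1 : A) ∈ W) {m n : ℕ} (h : m ≤ n) : W ^ m ≤ W ^ n :=
  pow_le_pow_right₀ (Submodule.one_le.2 hW) h

lemma monomial_mem_pow {W : Submodule k H} (hW : (1 : H) ∈ W) {y : κ → H} {L : List κ}
    (hy : ∀ j ∈ L, y j ∈ W) {d : κ → ℕ} {N : ℕ} (hd : ∀ j, d j ≤ N) :
    monomial y d L ∈ W ^ (L.length * N) := by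
  induction L with
  | nil => simpa [monomial] using Submodule.one_le.1 (le_refl (1 : Submodule k H))
  | cons j L ih =>
    rw [monomial, List.length_cons, add_mul, one_mul, pow_add]
    exact Submodule.mul_mem_mul (ih fun j hj => hy j (List.mem_cons_of_mem _ hj))
      (pow_le_pow_of_one_mem hW (hd j) (Submodule.pow_mem_pow W (hy j List.mem_cons_self) (d j)))

namespace LetterFamily

/-- There are `N ^ s.card` monomials with all exponents below `N`. They lie in `W ^ (s.card * N)`,
their coefficients from `V ^ N` lie in `W ^ N`, and independence makes the combination map
injective. -/
lemma pow_mul_finrank_le (F : LetterFamily gen κ) (hgen : IsLetterSystem gen) (s : Finset κ)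
    {V : Submodule k (groupLikeSpan k H)} (hV : V.FG) {W : Submodule k H} (hW : W.FG) (hW1 : (1 : H) ∈ W)
    (hVW : V.map (groupLikeSpan k H).val.toLinearMap ≤ W) (hy : ∀ j ∈ s, F.y j ∈ W) (N : ℕ) :
    N ^ s.card * Module.finrank k (V ^ N : Submodule k (groupLikeSpan k H)) ≤
      Module.finrank k (W ^ ((s.card + 1) * N) : Submodule k H) := by
  classical
  let ι := s → Fin N
  let d : ι → κ → ℕ := fun i n => if h : n ∈ s then (i ⟨n, h⟩ : ℕ) else 0
  let Φ : (ι → (V ^ N : Submodule k (groupLikeSpan k H))) →ₗ[k] H :=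
    ∑ i : ι, LinearMap.mulLeft k (monomial F.y (d i) s.toList) ∘ₗ
      (groupLikeSpan k H).val.toLinearMap ∘ₗ (V ^ N).subtype ∘ₗ LinearMap.proj i
  have hΦ : ∀ c, Φ c = ∑ i : ι, monomial F.y (d i) s.toList * ((c i : groupLikeSpan k H) : H) :=
    fun c => by simp [Φ]
  have hinj : Function.Injective Φ := by
    rw [injective_iff_map_eq_zero]
    intro c hc
    rw [hΦ] at hc
    have := F.monomial_independent hgen s.nodup_toList Finset.univ d
      (fun i => ((c i : groupLikeSpan k H) : H)) (fun i _ => (c i : groupLikeSpan k H).2) ?_ hc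
    · ext i
      exact this i (Finset.mem_univ i)
    · intro i _ i' _ h
      funext n
      have := h n (by simp)
      simp only [d, n.2, dif_pos] at this
      exact Fin.ext this
  have hmem : ∀ c, Φ c ∈ W ^ ((s.card + 1) * N) := fun c => by
    rw [hΦ]
    refine sum_mem fun i _ => ?_
    rw [add_mul, one_mul, pow_add]
    refine Submodule.mul_mem_mul ?_ ?_
    · rw [← Finset.length_toList]
      refine monomial_mem_pow hW1 (by simpa using hy) fun j => ?_
      dsimp only [d]
      split_ifs
      · exact (Fin.is_lt _).le
      · exact Nat.zero_le _
    · have h1 : (V ^ N).map (groupLikeSpan k H).val.toLinearMap ≤ W ^ N := by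
        rw [Submodule.map_pow]
        exact pow_le_pow_left' hVW N
      exact h1 (Submodule.mem_map_of_mem (c i).2)
  have : Module.Finite k (W ^ ((s.card + 1) * N) : Submodule k H) :=
    Module.Finite.iff_fg.2 (hW.pow _)
  have : ∀ n, Module.Finite k (V ^ n : Submodule k (groupLikeSpan k H)) :=
    fun n => Module.Finite.iff_fg.2 (hV.pow n)
  have h := LinearMap.finrank_le_finrank_of_injective
    (f := Φ.codRestrict (W ^ ((s.card + 1) * N)) hmem)
    (fun a b hab => hinj (congrArg Subtype.val hab))
  rw [Module.finrank_pi_fintype] at h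
  simpa [ι] using h

theorem gkDim_add_card_le (F : LetterFamily gen κ) (hgen : IsLetterSystem gen) (s : Finset κ) :
    gkDim k (groupLikeSpan k H) + s.card ≤ gkDim k H := by
  classical
  have key : ∀ V : Submodule k (groupLikeSpan k H), V.FG → (1 : groupLikeSpan k H) ∈ V →
      Filter.limsup (fun n : ℕ => ENNReal.ofReal
        (Real.log (Module.finrank k (V ^ n : Submodule k (groupLikeSpan k H))) / Real.log n))
        Filter.atTop + s.card ≤ gkDim k H := by
    intro V hV h1
    set W : Submodule k H := V.map (groupLikeSpan k H).val.toLinearMap ⊔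
      Submodule.span k (F.y '' s) with hWdef
    have hW : W.FG := (hV.map _).sup (Submodule.fg_span (s.finite_toSet.image _))
    have hW1 : (1 : H) ∈ W := Submodule.mem_sup_left ⟨1, h1, rfl⟩
    have hy : ∀ j ∈ s, F.y j ∈ W := fun j hj =>
      Submodule.mem_sup_right (Submodule.subset_span ⟨j, hj, rfl⟩)
    refine (limsup_log_add_le _
      (fun n => Module.finrank k (W ^ n : Submodule k H)) s.card (s.card + 1) (Nat.succ_pos _)
      (fun N => ?_) (F.pow_mul_finrank_le hgen s hV hW hW1 le_sup_left hy)).trans ?_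
    · have : Module.Finite k (V ^ N : Submodule k (groupLikeSpan k H)) :=
        Module.Finite.iff_fg.2 (hV.pow _)
      rw [Module.finrank_pos_iff_exists_ne_zero]
      refine ⟨⟨1, ?_⟩, fun h => ?_⟩
      · have := Submodule.pow_mem_pow V h1 N
        rwa [one_pow] at this
      · have h2 : (1 : groupLikeSpan k H) = 0 := congrArg Subtype.val h
        have h3 : (1 : H) = 0 := congrArg Subtype.val h2
        have h4 := Bialgebra.counit_one (R := k) (A := H)
        rw [h3, map_zero] at h4
        exact zero_ne_one h4
    · exact le_iSup₂_of_le W hW (le_iSup_of_le hW1 le_rfl)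
  -- The case of the scalars alone shows that `s.card` can be subtracted, so that the supremum over
  -- `V` can be taken termwise.
  have hs : (s.card : ENNReal) ≤ gkDim k H :=
    le_add_self.trans (key (Submodule.span k {1}) (Submodule.fg_span_singleton 1)
      (Submodule.mem_span_singleton_self 1))
  rw [← ENNReal.le_sub_iff_add_le_right (ENNReal.natCast_ne_top _) hs]
  refine iSup₂_le fun V hV => iSup_le fun h1 => ?_
  exact ENNReal.le_sub_of_add_le_right (ENNReal.natCast_ne_top _) (key V hV h1)

/-- A letter family indexed by `κ` raises the Gelfand-Kirillov dimension by the size of `κ`. -/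
theorem gkDim_add_toENat_le (F : LetterFamily gen κ) (hgen : IsLetterSystem gen) :
    gkDim k (groupLikeSpan k H) + ((Cardinal.toENat (Cardinal.mk κ) : ℕ∞) : ENNReal) ≤
      gkDim k H := by
  classical
  rcases finite_or_infinite κ with hκ | hκ
  · have := Fintype.ofFinite κ
    simpa using F.gkDim_add_card_le hgen Finset.univ
  · suffices h : gkDim k H = ⊤ by rw [h]; exact le_top
    by_contra h
    obtain ⟨n, hn⟩ := ENNReal.exists_nat_gt h
    obtain ⟨s, -, rfl⟩ := (Set.infinite_univ (α := κ)).exists_subset_card_eq n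
    exact absurd (le_add_self.trans (F.gkDim_add_card_le hgen s)) hn.not_ge

end LetterFamily

end GKDim

/-! ### Conjugation by group-like elements -/

section Conjugation

variable {k H : Type*} [Field k] [Ring H] [HopfAlgebra k H]

variable (k H) in
/-- Conjugation by group-like elements. -/
noncomputable def conj : GroupLike k H →* Module.End k H where
  toFun a := LinearMap.mulLeft k (a : H) ∘ₗ LinearMap.mulRight k ((a⁻¹ : GroupLike k H) : H)
  map_one' := by
    ext x
    simp only [inv_one, GroupLike.val_one, LinearMap.mulLeft_one, LinearMap.mulRight_one]
    rfl
  map_mul' a b := by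
    ext x
    rw [mul_inv_rev, Module.End.mul_apply]
    simp only [LinearMap.comp_apply, LinearMap.mulLeft_apply, LinearMap.mulRight_apply,
      GroupLike.val_mul, mul_assoc]

lemma conj_apply (a : GroupLike k H) (x : H) :
    conj k H a x = (a : H) * x * ((a⁻¹ : GroupLike k H) : H) :=
  (mul_assoc _ _ _).symm

lemma invConj_eq_conj (g : GroupLike k H) : invConj g = conj k H g⁻¹ := by
  ext x
  simp only [invConj, conj, MonoidHom.coe_mk, OneHom.coe_mk, inv_inv]

lemma conj_conj (a b : GroupLike k H) (x : H) : conj k H a (conj k H b x) = conj k H (a * b) x := by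
  rw [map_mul]; rfl

lemma conj_mem_C₀ (a : GroupLike k H) {c : H} (hc : c ∈ C₀ k H) : conj k H a c ∈ C₀ k H := by
  rw [conj_apply]
  exact mul_mem_C₀ (mul_mem_C₀ (groupLike_mem_C₀ _) hc) (groupLike_mem_C₀ _)

lemma SkewRel.conj {g : GroupLike k H} {u : H} (hu : SkewRel g u) (a : GroupLike k H) :
    SkewRel (a * g * a⁻¹) (HopfGK.conj k H a u) := by
  have h1 := (a⁻¹).2.comul_eq_tmul_self
  have h2 : (a : H) * ((a⁻¹ : GroupLike k H) : H) = 1 := groupLike_mul_inv a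
  unfold SkewRel at hu ⊢
  rw [conj_apply, Bialgebra.comul_mul, Bialgebra.comul_mul, h1, hu, a.2.comul_eq_tmul_self]
  simp only [mul_add, add_mul, Algebra.TensorProduct.tmul_mul_tmul, mul_one, h2,
    GroupLike.val_mul]

variable (k H) in
/-- The space of skew primitive elements of weight `g`, including `0`. -/
noncomputable def skewSpace (g : GroupLike k H) : Submodule k H where
  carrier := {u | SkewRel g u}
  zero_mem' := by simp [SkewRel]
  add_mem' {a b} ha hb := by
    have ha' : SkewRel g a := ha
    have hb' : SkewRel g b := hb
    unfold SkewRel at ha' hb'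
    change SkewRel g (a + b)
    rw [SkewRel, map_add, ha', hb', TensorProduct.add_tmul, TensorProduct.tmul_add]
    abel
  smul_mem' r a ha := by
    have ha' : SkewRel g a := ha
    unfold SkewRel at ha'
    change SkewRel g (r • a)
    rw [SkewRel, map_smul, ha', smul_add, TensorProduct.smul_tmul', TensorProduct.tmul_smul]

lemma invConj_mem_skewSpace (g : GroupLike k H) {u : H} (hu : u ∈ skewSpace k H g) :
    invConj g u ∈ skewSpace k H g := by
  have := SkewRel.conj (show SkewRel g u from hu) g⁻¹
  rw [inv_inv, inv_mul_cancel, one_mul, ← invConj_eq_conj] at this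
  exact this

lemma invConj_mem_C₀ (g : GroupLike k H) {u : H} (hu : u ∈ C₀ k H) : invConj g u ∈ C₀ k H := by
  rw [invConj_eq_conj]
  exact conj_mem_C₀ _ hu

lemma aeval_apply_mem {V : Type*} [AddCommGroup V] [Module k V] {f : Module.End k V}
    {S : Submodule k V} (hf : ∀ x ∈ S, f x ∈ S) (p : Polynomial k) {x : V} (hx : x ∈ S) :
    Polynomial.aeval f p x ∈ S := by
  have hpow : ∀ n, (f ^ n) x ∈ S := fun n => by
    induction n with
    | zero => simpa using hx
    | succ n ih => rw [pow_succ', Module.End.mul_apply]; exact hf _ ih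
  rw [Polynomial.aeval_eq_sum_range, LinearMap.sum_apply]
  exact sum_mem fun i _ => S.smul_mem _ (hpow i)

lemma aeval_invConj_mem_C₀ (g : GroupLike k H) (p : Polynomial k) {x : H} (hx : x ∈ C₀ k H) :
    Polynomial.aeval (invConj g) p x ∈ C₀ k H :=
  aeval_apply_mem (fun _ => invConj_mem_C₀ g) p hx

lemma aeval_invConj_mem_skewSpace (g : GroupLike k H) (p : Polynomial k) {x : H}
    (hx : x ∈ skewSpace k H g) : Polynomial.aeval (invConj g) p x ∈ skewSpace k H g :=
  aeval_apply_mem (fun _ => invConj_mem_skewSpace g) p hx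

lemma aeval_X_sub_C_pow (g : GroupLike k H) (c : k) (n : ℕ) :
    Polynomial.aeval (invConj g) ((Polynomial.X - Polynomial.C c) ^ n) =
      (invConj g - c • (1 : Module.End k H)) ^ n := by
  simp [Algebra.algebraMap_eq_smul_one]

lemma dimInf_quotient_le {V κ : Type v} [AddCommGroup V] [Module k V]
    {A B : Submodule k V} {y : κ → V} (h : A ≤ B ⊔ Submodule.span k (Set.range y)) :
    dimInf k (A ⧸ B.submoduleOf A) ≤ ((Cardinal.toENat (Cardinal.mk κ) : ℕ∞) : ENNReal) := by
  have h1 : Module.rank k (A ⧸ B.submoduleOf A) ≤ Cardinal.mk κ := by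
    have hker : LinearMap.ker (B.mkQ ∘ₗ A.subtype) = B.submoduleOf A := by
      rw [LinearMap.ker_comp, Submodule.ker_mkQ]; rfl
    have hrange : LinearMap.range (B.mkQ ∘ₗ A.subtype) ≤
        Submodule.span k (Set.range (B.mkQ ∘ y)) := by
      rw [LinearMap.range_comp, Submodule.range_subtype, Set.range_comp, Submodule.span_image]
      refine (Submodule.map_mono h).trans ?_
      rw [Submodule.map_sup, Submodule.mkQ_map_self, bot_sup_eq]
    rw [← hker, (LinearMap.quotKerEquivRange _).rank_eq]
    exact (Submodule.rank_mono hrange).trans ((rank_span_le _).trans Cardinal.mk_range_le)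
  unfold dimInf
  exact_mod_cast OrderHomClass.mono Cardinal.toENat h1

end Conjugation

/-! ### Letters with a generic commutator of finite level -/

section FiniteLevel

variable {k H : Type*} [Field k] [Ring H] [HopfAlgebra k H]

/-- A commutator that is `1` or not a root of unity. -/
def IsGeneric (c : k) : Prop := c = 1 ∨ ¬ IsRootOfUnity c

lemma IsGeneric.sum_pow_ne_zero [CharZero k] {c : k} (hc : IsGeneric c) {n : ℕ} (hn : 0 < n) :
    ∑ i ∈ Finset.range n, c⁻¹ ^ i ≠ 0 := by
  rcases hc with rfl | hc
  · simp [hn.ne']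
  · intro h
    refine hc ⟨n, hn, ?_⟩
    have h1 := geom_sum_mul c⁻¹ n
    rw [h, zero_mul] at h1
    rw [← inv_inj, ← inv_pow, inv_one]
    exact (sub_eq_zero.1 h1.symm)

variable (k H) in
/-- Skew primitive elements with a generic commutator of level at most `l`. -/
def genericLetters (l : ℕ) : Set (GroupLike k H × H) :=
  {x | SkewRel x.1 x.2 ∧ ∃ c : k, c ≠ 0 ∧ IsGeneric c ∧
    ((invConj x.1 - c • (1 : Module.End k H)) ^ l) x.2 ∈ C₀ k H}

lemma sub_smul_mem_C₀ (g : GroupLike k H) (c : k) {x : H} (hx : x ∈ C₀ k H) :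
    (invConj g - c • (1 : Module.End k H)) x ∈ C₀ k H :=
  sub_mem (invConj_mem_C₀ g hx) (Submodule.smul_mem _ c hx)

lemma semiconjBy_conj (a g : GroupLike k H) (c : k) (n : ℕ) :
    SemiconjBy (conj k H a) ((invConj g - c • (1 : Module.End k H)) ^ n)
      ((invConj (a * g * a⁻¹) - c • (1 : Module.End k H)) ^ n) := by
  refine SemiconjBy.pow_right ?_ n
  rw [SemiconjBy, invConj_eq_conj, invConj_eq_conj, mul_sub, sub_mul, ← map_mul, ← map_mul,
    mul_smul_comm, smul_mul_assoc, mul_one, one_mul]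
  congr 2
  group

lemma isLetterSystem_genericLetters : IsLetterSystem (genericLetters k H) where
  skew h := h.1
  mono := monotone_nat_of_le_succ fun l x ⟨h1, c, h2, h3, h4⟩ => by
    refine ⟨h1, c, h2, h3, ?_⟩
    rw [pow_succ', Module.End.mul_apply]
    exact sub_smul_mem_C₀ _ _ h4
  conj {l g u l' a v} h _ := by
    obtain ⟨h1, c, h2, h3, h4⟩ := h
    rw [← conj_apply]
    refine ⟨a * g * a⁻¹, h1.conj a, c, h2, h3, ?_⟩
    have := LinearMap.congr_fun (semiconjBy_conj a g c l) u
    rw [Module.End.mul_apply, Module.End.mul_apply] at this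
    dsimp only
    rw [← this]
    exact conj_mem_C₀ _ h4

/-- With `T = invConj g - c`, the element equals `-c⁻¹ • conj g (T u)`. Conjugation by `g` commutes
with `T`, so one power of `T` is used up and the level drops by one. -/
lemma genericLetters_twist {l : ℕ} {g : GroupLike k H} {u : H} {c : k} (hu : SkewRel g u)
    (hc : c ≠ 0) (hg : IsGeneric c)
    (h : ((invConj g - c • (1 : Module.End k H)) ^ (l + 1)) u ∈ C₀ k H) :
    (g, (g : H) * u * ((g⁻¹ : GroupLike k H) : H) - c⁻¹ • u) ∈ genericLetters k H l := by
  rw [← conj_apply]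
  set T := invConj g - c • (1 : Module.End k H) with hT
  have h1 : conj k H g u - c⁻¹ • u = -c⁻¹ • conj k H g (T u) := by
    rw [hT, LinearMap.sub_apply, map_sub, invConj_eq_conj, conj_conj, mul_inv_cancel, map_one,
      LinearMap.smul_apply, Module.End.one_apply, map_smul, smul_sub, neg_smul,
      neg_smul, smul_smul, inv_mul_cancel₀ hc, one_smul]
    abel
  have h2 : (T ^ l) (conj k H g (T u)) = conj k H g ((T ^ (l + 1)) u) := by
    have h3 := semiconjBy_conj g g c l
    rw [mul_inv_cancel_right] at h3
    have := LinearMap.congr_fun h3 (T u)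
    rw [Module.End.mul_apply, Module.End.mul_apply] at this
    rw [pow_succ, Module.End.mul_apply, this]
  refine ⟨?_, c, hc, hg, ?_⟩
  · have h4 := hu.conj g
    rw [mul_inv_cancel_right] at h4
    exact (skewSpace k H g).sub_mem h4 ((skewSpace k H g).smul_mem _ hu)
  · dsimp only
    rw [h1, map_smul, h2]
    exact Submodule.smul_mem _ _ (conj_mem_C₀ _ h)

lemma exists_dual_of_linearIndependent {ι V : Type*} [AddCommGroup V] [Module k V] {v : ι → V}
    (hv : LinearIndependent k v) (j : ι) :
    ∃ f : V →ₗ[k] k, f (v j) = 1 ∧ ∀ i, i ≠ j → f (v i) = 0 := by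
  obtain ⟨f, hf⟩ := LinearMap.exists_extend (Finsupp.lapply j ∘ₗ hv.repr)
  have h : ∀ i, f (v i) = Finsupp.single i (1 : k) j := fun i => by
    have h1 := LinearMap.congr_fun hf ⟨v i, Submodule.subset_span ⟨i, rfl⟩⟩
    have h2 := hv.repr_eq_single i ⟨v i, Submodule.subset_span ⟨i, rfl⟩⟩ rfl
    simpa [h2] using h1
  exact ⟨f, by simp [h], fun i hi => by simp [h, hi]⟩

/-- There is a letter family that spans all skew primitive elements with a generic commutator,
modulo `C₀`. -/
theorem exists_letterFamily_generic (k : Type u) (H : Type v) [Field k] [Ring H] [HopfAlgebra k H]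
    [CharZero k] :
    ∃ (κ : Type v) (F : LetterFamily (genericLetters k H) κ),
      Ystar k H ≤ C₀ k H ⊔ Submodule.span k (Set.range F.y) := by
  -- All weights and scalars are pooled within a level: a basis modulo `E l` is chosen among the
  -- letters of level `l + 1`, and its dual forms, pulled back to `H`, serve as the `φ j`.
  let E : ℕ → Submodule k H := fun l => C₀ k H ⊔ Submodule.span k (Prod.snd '' genericLetters k H l)
  have hE : ∀ {l x}, x ∈ genericLetters k H l → x.2 ∈ E l := fun hx =>
    Submodule.mem_sup_right (Submodule.subset_span ⟨_, hx, rfl⟩)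
  let vec : ∀ l, {x // x ∈ genericLetters k H (l + 1)} → H ⧸ E l := fun l x => (E l).mkQ x.1.2
  have hex := fun l => exists_linearIndependent' k (vec l)
  choose κ a _ hspan hli using hex
  have hcex : ∀ j : Σ l, κ l, ∃ c : k, c ≠ 0 ∧ IsGeneric c ∧
      ((invConj (a j.1 j.2).1.1 - c • (1 : Module.End k H)) ^ (j.1 + 1)) (a j.1 j.2).1.2 ∈
        C₀ k H := fun j => (a j.1 j.2).2.2
  choose c hc0 hcg hc using hcex
  have hφex := fun j : Σ l, κ l => exists_dual_of_linearIndependent (hli j.1) j.2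
  choose f hf1 hf0 using hφex
  let F : LetterFamily (genericLetters k H) (Σ l, κ l) :=
    { y := fun j => (a j.1 j.2).1.2
      g := fun j => (a j.1 j.2).1.1
      lev := fun j => j.1
      q := fun j => (c j)⁻¹
      φ := fun j => f j ∘ₗ (E j.1).mkQ
      mem := fun j => (a j.1 j.2).2
      twist := fun j => ⟨_, genericLetters_twist (a j.1 j.2).2.1 (hc0 j) (hcg j) (hc j)⟩
      quantum_ne_zero := fun j n hn => (hcg j).sum_pow_ne_zero hn
      φ_C₀ := fun j x hx => by
        have : (E j.1).mkQ x = 0 := by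
          rw [Submodule.mkQ_apply, Submodule.Quotient.mk_eq_zero]
          exact Submodule.mem_sup_left hx
        rw [LinearMap.comp_apply, this, map_zero]
      φ_gen := fun j x hx => by
        have : (E j.1).mkQ x.2 = 0 := by
          rw [Submodule.mkQ_apply, Submodule.Quotient.mk_eq_zero]
          exact hE hx
        rw [LinearMap.comp_apply, this, map_zero]
      φ_self := fun j => hf1 j
      φ_ne := by
        rintro ⟨l, i⟩ ⟨l', j⟩ hij hl
        dsimp only at hl
        subst hl
        exact hf0 ⟨l, j⟩ i fun h => hij (by rw [h]) }
  refine ⟨_, F, ?_⟩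
  have hEle : ∀ l, E l ≤ C₀ k H ⊔ Submodule.span k (Set.range F.y) := by
    intro l
    induction l with
    | zero =>
      refine sup_le le_sup_left (Submodule.span_le.2 ?_)
      rintro _ ⟨x, ⟨_, c, _, _, h⟩, rfl⟩
      exact Submodule.mem_sup_left (by simpa using h)
    | succ l ih =>
      refine sup_le le_sup_left (Submodule.span_le.2 ?_)
      rintro _ ⟨x, hx, rfl⟩
      have h1 : vec l ⟨x, hx⟩ ∈ Submodule.span k (Set.range (vec l ∘ a l)) := by
        rw [hspan]
        exact Submodule.subset_span ⟨_, rfl⟩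
      have h2 : Set.range (vec l ∘ a l) = (E l).mkQ '' Set.range fun i => (a l i).1.2 := by
        rw [← Set.range_comp]; rfl
      rw [h2, Submodule.span_image] at h1
      obtain ⟨s, hs, hsx⟩ := h1
      have h3 : s - x.2 ∈ E l := (Submodule.Quotient.eq _).1 hsx
      have h4 : s ∈ Submodule.span k (Set.range F.y) := by
        refine Submodule.span_mono ?_ hs
        rintro _ ⟨i, rfl⟩
        exact ⟨⟨l, i⟩, rfl⟩
      have := sub_mem (Submodule.mem_sup_right (S := C₀ k H) h4) (ih h3)
      rwa [sub_sub_cancel] at this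
  refine Submodule.span_le.2 ?_
  rintro y ⟨g, c, n, ⟨h1, h2, h3, h4, h5⟩, hg⟩
  exact hEle n (hE (x := (g, y)) ⟨h1.2, c, h3, hg, h4⟩)

end FiniteLevel

/-! ### Primary decomposition in the locally finite case -/

section LocallyFinite

variable {k H : Type*} [Field k] [Ring H] [HopfAlgebra k H]

lemma mem_of_generalizedEigenvector {g : GroupLike k H} {z : H} (hz : SkewRel g z) {c : k} {n : ℕ}
    (h : ((invConj g - c • (1 : Module.End k H)) ^ n) z ∈ C₀ k H) :
    z ∈ C₀ k H ⊔ Ysqrt k H ⊔ Ystar k H := by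
  classical
  by_cases hzC : z ∈ C₀ k H
  · exact Submodule.mem_sup_left (Submodule.mem_sup_left hzC)
  -- Conjugation is invertible and preserves `C₀`, so `0` cannot be a generalized eigenvalue modulo
  -- `C₀`.
  have hc : c ≠ 0 := by
    rintro rfl
    rw [zero_smul, sub_zero, invConj_eq_conj, ← map_pow] at h
    have h1 := conj_mem_C₀ ((g⁻¹ ^ n)⁻¹) h
    rw [conj_conj, inv_mul_cancel, map_one] at h1
    exact hzC h1
  have hex : ∃ n, ((invConj g - c • (1 : Module.End k H)) ^ n) z ∈ C₀ k H := ⟨n, h⟩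
  have hcomm : HasCommutatorOfLevel g z c (Nat.find hex) :=
    ⟨⟨fun h0 => hzC (h0 ▸ zero_mem _), hz⟩, hzC, hc, Nat.find_spec hex,
      fun m hm => Nat.find_min hex hm⟩
  by_cases hg : c = 1 ∨ ¬ IsRootOfUnity c
  · exact Submodule.mem_sup_right (Submodule.subset_span ⟨g, c, _, hcomm, hg⟩)
  · rw [not_or, not_not] at hg
    exact Submodule.mem_sup_left
      (Submodule.mem_sup_right (Submodule.subset_span ⟨g, c, _, hcomm, hg.2, hg.1⟩))

/-- A skew primitive element on which `invConj` is locally finite modulo `C₀` is a sum of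
generalized eigenvectors. -/
lemma mem_of_aeval_mem [IsAlgClosed k] {g : GroupLike k H} (n : ℕ) :
    ∀ p : Polynomial k, p ≠ 0 → p.natDegree ≤ n → ∀ y : H, SkewRel g y →
      Polynomial.aeval (invConj g) p y ∈ C₀ k H → y ∈ C₀ k H ⊔ Ysqrt k H ⊔ Ystar k H := by
  induction n with
  | zero =>
    intro p hp hdeg y hy h
    rw [Polynomial.eq_C_of_natDegree_le_zero hdeg, Polynomial.aeval_C,
      Module.algebraMap_end_apply] at h
    have h0 : p.coeff 0 ≠ 0 := fun h0 =>
      hp (by rw [Polynomial.eq_C_of_natDegree_le_zero hdeg, h0, map_zero])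
    exact Submodule.mem_sup_left (Submodule.mem_sup_left ((Submodule.smul_mem_iff _ h0).1 h))
  | succ n ih =>
    intro p hp hdeg y hy h
    by_cases hlow : p.natDegree ≤ n
    · exact ih p hp hlow y hy h
    have hdeg0 : p.degree ≠ 0 := fun h0 => by
      rw [Polynomial.natDegree_eq_of_degree_eq_some h0] at hlow
      exact hlow (Nat.zero_le _)
    obtain ⟨c, hc⟩ := IsAlgClosed.exists_root p hdeg0
    obtain ⟨r, hr, hdvd⟩ := Polynomial.exists_eq_pow_rootMultiplicity_mul_and_not_dvd p hp c
    set m := p.rootMultiplicity c with hm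
    have hm0 : 0 < m := (Polynomial.rootMultiplicity_pos hp).2 hc
    have hr0 : r ≠ 0 := fun h0 => hp (by rw [hr, h0, mul_zero])
    have hrdeg : r.natDegree ≤ n := by
      have h1 : p.natDegree = m + r.natDegree := by
        conv_lhs => rw [hr]
        rw [((Polynomial.monic_X_sub_C c).pow m).natDegree_mul' hr0, Polynomial.natDegree_pow,
          Polynomial.natDegree_X_sub_C, mul_one]
      omega
    have hcop : IsCoprime ((Polynomial.X - Polynomial.C c) ^ m) r :=
      IsCoprime.pow_left ((Polynomial.irreducible_X_sub_C c).coprime_iff_not_dvd.2 hdvd)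
    -- The Bézout identity splits `y` into a part killed modulo `C₀` by `r`, of smaller degree, and
    -- a generalized eigenvector for `c`.
    obtain ⟨a, b, hab⟩ := hcop
    set T := invConj g with hT
    have hsplit : y = Polynomial.aeval T (a * (Polynomial.X - Polynomial.C c) ^ m) y +
        Polynomial.aeval T (b * r) y := by
      rw [← LinearMap.add_apply, ← map_add, hab, map_one, Module.End.one_apply]
    have hskew : ∀ q : Polynomial k, SkewRel g (Polynomial.aeval T q y) := fun q =>
      aeval_invConj_mem_skewSpace g q hy
    have hkill : ∀ q : Polynomial k, p ∣ q → Polynomial.aeval T q y ∈ C₀ k H := by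
      rintro _ ⟨q, rfl⟩
      rw [mul_comm, map_mul, Module.End.mul_apply]
      exact aeval_invConj_mem_C₀ g q h
    rw [hsplit]
    refine add_mem (ih r hr0 hrdeg _ (hskew _) ?_)
      (mem_of_generalizedEigenvector (hskew _) (c := c) (n := m) ?_)
    · rw [← Module.End.mul_apply, ← map_mul]
      exact hkill _ ⟨a, by rw [hr]; ring⟩
    · rw [← aeval_X_sub_C_pow, ← Module.End.mul_apply, ← map_mul]
      exact hkill _ ⟨b, by rw [hr]; ring⟩

lemma Z_le_of_locallyFinite [IsAlgClosed k]
    (h : ∀ (g : GroupLike k H) (y : H), SkewRel g y →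
      ∃ p : Polynomial k, p ≠ 0 ∧ Polynomial.aeval (invConj g) p y ∈ C₀ k H) :
    Z k H ≤ C₀ k H ⊔ Ysqrt k H ⊔ Ystar k H := by
  refine Submodule.span_le.2 ?_
  rintro y (rfl | ⟨g, hy⟩)
  · exact Submodule.mem_sup_left (Submodule.mem_sup_left (groupLikeSpan k H).one_mem)
  · obtain ⟨p, hp, hpy⟩ := h g y hy.2
    exact mem_of_aeval_mem _ p hp le_rfl y hy.2 hpy

end LocallyFinite

/-! ### Infinite dimension in the remaining case -/

section NotLocallyFinite

variable {k H : Type*} [Field k] [Ring H] [HopfAlgebra k H]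

/-- The iterated conjugates of `y` by its weight `g`. -/
def orbitLetters (g : GroupLike k H) (y : H) (l : ℕ) : Set (GroupLike k H × H) :=
  {x | x.1 = g ∧ ∃ i : ℤ, i ≤ l ∧ x.2 = conj k H (g ^ (-i)) y}

/-- Conjugation by `g` lowers the index `i` by one, which is why all integers `i ≤ l`, also negative
ones, are admitted at level `l`. -/
lemma isLetterSystem_orbitLetters {g : GroupLike k H} {y : H} (hy : SkewRel g y) :
    IsLetterSystem (orbitLetters g y) where
  skew {l g' u} h := by
    obtain ⟨h1, i, -, h2⟩ := h
    dsimp only at h1 h2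
    subst h1 h2
    have := hy.conj (g' ^ (-i))
    rwa [(Commute.zpow_left (Commute.refl g') (-i)).eq, mul_inv_cancel_right] at this
  mono := monotone_nat_of_le_succ fun l x ⟨h1, i, hi, h2⟩ => ⟨h1, i, by push_cast; omega, h2⟩
  conj {l g' u l' a v} h ha := by
    obtain ⟨h1, i, hi, h2⟩ := h
    obtain ⟨h3, -⟩ := ha
    dsimp only at h1 h2 h3
    subst h1 h2 h3
    refine ⟨a, rfl, i - 1, by omega, ?_⟩
    dsimp only
    rw [← conj_apply, conj_conj, ← zpow_one_add,
      show 1 + -i = -(i - 1) by ring]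

/-- If no nonzero polynomial in `invConj g` maps `y` into `C₀`, then each conjugate of `y` is
independent of the preceding ones. -/
lemma conj_notMem_of_not_locallyFinite {g : GroupLike k H} {y : H}
    (h : ∀ p : Polynomial k, Polynomial.aeval (invConj g) p y ∈ C₀ k H → p = 0) (j : ℕ) :
    conj k H (g ^ (-((j : ℤ) + 1))) y ∉
      C₀ k H ⊔ Submodule.span k (Prod.snd '' orbitLetters g y j) := by
  set T := invConj g with hT
  have hTpow : ∀ (N : ℕ) (i : ℤ) (m : ℕ), N + i = m →
      (T ^ N) (conj k H (g ^ (-i)) y) = Polynomial.aeval T (Polynomial.X ^ m : Polynomial k) y := by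
    intro N i m hm
    rw [map_pow, Polynomial.aeval_X, hT, invConj_eq_conj, ← map_pow, ← map_pow, conj_conj]
    congr 2
    rw [← zpow_natCast, ← zpow_natCast, inv_zpow', inv_zpow', ← zpow_add, ← hm]
    congr 1
    ring
  have hTC : ∀ (N : ℕ) {c : H}, c ∈ C₀ k H → (T ^ N) c ∈ C₀ k H := fun N c hc => by
    have := aeval_invConj_mem_C₀ g (Polynomial.X ^ N) hc
    rwa [map_pow, Polynomial.aeval_X] at this
  -- A power `T ^ N` clears the negative indices: modulo `C₀`, the span up to level `j` then
  -- consists of polynomials in `T` of degree at most `N + j`, applied to `y`.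
  let P : H → Prop := fun z => ∃ (N : ℕ) (p : Polynomial k),
    p ∈ Polynomial.degreeLT k (N + j + 1) ∧ (T ^ N) z - Polynomial.aeval T p y ∈ C₀ k H
  have hraise : ∀ {z : H} {N : ℕ} {p : Polynomial k}, p ∈ Polynomial.degreeLT k (N + j + 1) →
      (T ^ N) z - Polynomial.aeval T p y ∈ C₀ k H → ∀ m : ℕ, ∃ p' : Polynomial k,
        p' ∈ Polynomial.degreeLT k (m + N + j + 1) ∧
          (T ^ (m + N)) z - Polynomial.aeval T p' y ∈ C₀ k H := by
    intro z N p hp hz m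
    refine ⟨Polynomial.X ^ m * p, ?_, ?_⟩
    · rw [Polynomial.mem_degreeLT] at hp ⊢
      rcases eq_or_ne p 0 with rfl | hp0
      · rw [mul_zero, Polynomial.degree_zero]
        exact WithBot.bot_lt_coe _
      · rw [← Polynomial.natDegree_lt_iff_degree_lt hp0] at hp
        rw [← Polynomial.natDegree_lt_iff_degree_lt (mul_ne_zero (by simp) hp0),
          Polynomial.natDegree_mul (by simp) hp0, Polynomial.natDegree_X_pow]
        omega
    · have := hTC m hz
      rw [map_sub] at this
      rwa [pow_add, map_mul, map_pow, Polynomial.aeval_X]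
  have hP : ∀ z ∈ C₀ k H ⊔ Submodule.span k (Prod.snd '' orbitLetters g y j), P z := by
    have hadd : ∀ a b, P a → P b → P (a + b) := by
      rintro a b ⟨N, p, hp, ha⟩ ⟨N', p', hp', hb⟩
      obtain ⟨r, hr, ha'⟩ := hraise hp ha N'
      obtain ⟨r', hr', hb'⟩ := hraise hp' hb N
      rw [add_comm N N'] at hr' hb'
      refine ⟨N' + N, r + r', add_mem hr hr', ?_⟩
      have := add_mem ha' hb'
      rw [map_add, map_add, LinearMap.add_apply]
      convert this using 1
      abel
    intro z hz
    obtain ⟨c, hc, s, hs, rfl⟩ := Submodule.mem_sup.1 hz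
    refine hadd _ _ ⟨0, 0, zero_mem _, by simpa using hc⟩ ?_
    clear hz
    induction hs using Submodule.span_induction with
    | mem s hs =>
      obtain ⟨⟨_, _⟩, ⟨-, i, hi, rfl⟩, rfl⟩ := hs
      refine ⟨i.natAbs, Polynomial.X ^ (i.natAbs + i).toNat, ?_, ?_⟩
      · rw [Polynomial.mem_degreeLT, Polynomial.degree_X_pow]
        have hlt : (i.natAbs + i).toNat < i.natAbs + j + 1 := by
          omega
        exact_mod_cast hlt
      · dsimp only
        rw [hTpow _ i (i.natAbs + i).toNat (by omega), sub_self]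
        exact zero_mem _
    | zero => exact ⟨0, 0, zero_mem _, by simp⟩
    | add a b ha hb h1 h2 =>
      exact hadd _ _ h1 h2
    | smul r a ha h1 =>
      obtain ⟨N, p, hp, h2⟩ := h1
      refine ⟨N, r • p, Submodule.smul_mem _ _ hp, ?_⟩
      rw [map_smul, map_smul, LinearMap.smul_apply, ← smul_sub]
      exact Submodule.smul_mem _ _ h2
  intro hmem
  obtain ⟨N, p, hp, h1⟩ := hP _ hmem
  -- The next conjugate becomes `T ^ (N + j + 1) y`, so `X ^ (N + j + 1)` would equal a polynomial
  -- of smaller degree.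
  rw [hTpow N _ (N + j + 1) (by push_cast; ring), ← LinearMap.sub_apply, ← map_sub] at h1
  have h2 := sub_eq_zero.1 (h _ h1)
  rw [Polynomial.mem_degreeLT, ← h2, Polynomial.degree_X_pow] at hp
  exact lt_irrefl _ hp

/-- Conjugation by `g` sends each letter to the preceding one, which has lower level. So `q = 0`,
every quantum integer is `1`, and the letter family is infinite. -/
theorem gkDim_eq_top_of_not_locallyFinite {g : GroupLike k H} {y : H} (hy : SkewRel g y)
    (h : ∀ p : Polynomial k, Polynomial.aeval (invConj g) p y ∈ C₀ k H → p = 0) :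
    gkDim k H = ⊤ := by
  have hφex : ∀ j : ℕ, ∃ φ : H →ₗ[k] k, φ (conj k H (g ^ (-((j : ℤ) + 1))) y) = 1 ∧
      C₀ k H ⊔ Submodule.span k (Prod.snd '' orbitLetters g y j) ≤ LinearMap.ker φ := fun j => by
    obtain ⟨f, hf, hle⟩ :=
      Submodule.exists_le_ker_of_notMem (conj_notMem_of_not_locallyFinite h j)
    refine ⟨(f (conj k H (g ^ (-((j : ℤ) + 1))) y))⁻¹ • f, ?_, fun x hx => ?_⟩
    · rw [LinearMap.smul_apply, smul_eq_mul, inv_mul_cancel₀ hf]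
    · rw [LinearMap.mem_ker, LinearMap.smul_apply, LinearMap.mem_ker.1 (hle hx), smul_zero]
  choose φ hφ1 hφ0 using hφex
  let F : LetterFamily (orbitLetters g y) ℕ :=
    { y := fun j => conj k H (g ^ (-((j : ℤ) + 1))) y
      g := fun _ => g
      lev := fun j => j
      q := fun _ => 0
      φ := φ
      mem := fun j => ⟨rfl, (j : ℤ) + 1, by push_cast; exact le_rfl, rfl⟩
      twist := fun j => ⟨g, rfl, j, le_rfl, by
        dsimp only
        rw [zero_smul, sub_zero, ← conj_apply, conj_conj, ← zpow_one_add,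
          show 1 + -((j : ℤ) + 1) = -(j : ℤ) by ring]⟩
      quantum_ne_zero := fun j n hn => by
        rw [Finset.sum_eq_single 0 (fun i _ hi => zero_pow hi)
          (fun h0 => absurd (Finset.mem_range.2 hn) h0), pow_zero]
        exact one_ne_zero
      φ_C₀ := fun j c hc => hφ0 j (Submodule.mem_sup_left hc)
      φ_gen := fun j u hu => hφ0 j (Submodule.mem_sup_right (Submodule.subset_span ⟨u, hu, rfl⟩))
      φ_self := hφ1
      φ_ne := fun i j hij hl => absurd hl hij }
  have := F.gkDim_add_toENat_le (isLetterSystem_orbitLetters hy)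
  rw [Cardinal.mk_nat, Cardinal.toENat_eq_top.2 le_rfl, ENat.toENNReal_top, add_top] at this
  exact top_le_iff.1 this

end NotLocallyFinite

end HopfGK

/-- The argument does not use the commutativity of the group generated by the weights. -/
theorem theorem0p4 (k H : Type*) [Field k] [IsAlgClosed k] [CharZero k] [Ring H] [HopfAlgebra k H]
    (hab : ∀ a ∈ Subgroup.closure (HopfGK.Wtimes k H),
      ∀ b ∈ Subgroup.closure (HopfGK.Wtimes k H), a * b = b * a) :
    HopfGK.gkDim k (HopfGK.groupLikeSpan k H) +
        HopfGK.dimInf k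
          (HopfGK.Z k H ⧸ (HopfGK.C₀ k H ⊔ HopfGK.Ysqrt k H).submoduleOf (HopfGK.Z k H))
      ≤ HopfGK.gkDim k H ∧
    HopfGK.gkDim k (HopfGK.groupLikeSpan k H) +
        HopfGK.dimInf k
          (HopfGK.Ystar k H ⧸
            (HopfGK.Ystar k H ⊓ HopfGK.C₀ k H).submoduleOf (HopfGK.Ystar k H))
      ≤ HopfGK.gkDim k H := by
  obtain ⟨κ, F, hF⟩ := HopfGK.exists_letterFamily_generic k H
  have hbound := F.gkDim_add_toENat_le HopfGK.isLetterSystem_genericLetters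
  refine ⟨?_, ?_⟩
  -- If local finiteness fails for a single skew primitive element, the right-hand side is already
  -- infinite.
  · by_cases h : ∀ (g : GroupLike k H) (y : H), HopfGK.SkewRel g y →
      ∃ p : Polynomial k, p ≠ 0 ∧ Polynomial.aeval (HopfGK.invConj g) p y ∈ HopfGK.C₀ k H
    · refine (add_le_add le_rfl (HopfGK.dimInf_quotient_le (y := F.y) ?_)).trans hbound
      exact (HopfGK.Z_le_of_locallyFinite h).trans
        (sup_le le_sup_left (hF.trans (sup_le_sup_right le_sup_left _)))
    · push Not at h
      obtain ⟨g, y, hy, h⟩ := h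
      rw [HopfGK.gkDim_eq_top_of_not_locallyFinite hy
        fun p hp => by_contra fun h0 => h p h0 hp]
      exact le_top
  · refine (add_le_add le_rfl ?_).trans hbound
    have h : (HopfGK.Ystar k H ⊓ HopfGK.C₀ k H).submoduleOf (HopfGK.Ystar k H) =
        (HopfGK.C₀ k H).submoduleOf (HopfGK.Ystar k H) := by
      ext x
      simp [Submodule.submoduleOf]
    rw [h]
    exact HopfGK.dimInf_quotient_le hF
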